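/- Let $\mathcal M$ be a von Neumann algebra on a Hilbert space $H$ and let $a$ be a positive selfadjoint operator on $H$ affiliated with $\mathcal M$ (neither $a$ nor $a^{-1}$ is assumed to be bounded), with spectral decomposition $a=\int_0^\infty\lambda\,dP_\lambda$. Put $p_0=\int_{[0,1]}dP_\lambda$, $p_\infty=\mathbf 1-p_0$, $a_0=ap_0$, $a_\infty=ap_\infty$. For $i,j\in\{0,\infty\}$ and $\alpha,\beta>0$ let $\mathcal S_{i,j}^{\alpha,\beta}$ be the space of sesquilinear forms $(f,g)\mapsto\langle x\,a_j^{\beta}f,\,a_i^{\alpha}g\rangle$ with $x\in\mathcal M$, normed by the infimum of $\|x\|$ over all $x\in\mathcal M$ representing the form (this is $\|p_ixp_j\|$ if $a$ is injective). All forms are restricted to the common domain $\bigcap_{\gamma>0}\bigl(D(a_0^\gamma)\cap D(a_\infty^\gamma)\bigr)$, so that these spaces can be compared. Let $L_\infty(a_i^\alpha)=\mathcal S_{i,i}^{\alpha/2,\alpha/2}$. Every intersection below carries the coarsest topology making the inclusions into the intersected spaces continuous, and every union carries the finest locally convex topology making the inclusions of the united spaces continuous. Set $$\underline{\mathfrak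 L_{0,\infty}}=\bigcup_{\beta>0}\bigcap_{\alpha>0}\mathcal S_{0,\infty}^{\alpha,\beta},\qquad \overline{\mathfrak L_{0,\infty}}=\bigcap_{\alpha>0}\bigcup_{\beta>0}\mathcal S_{0,\infty}^{\alpha,\beta},$$ $$\underline{\mathfrak L_{\infty,0}}=\bigcup_{\beta>0}\bigcap_{\alpha>0}\mathcal S_{\infty,0}^{\beta,\alpha},\qquad \overline{\mathfrak L_{\infty,0}}=\bigcap_{\alpha>0}\bigcup_{\beta>0}\mathcal S_{\infty,0}^{\beta,\alpha},$$ $$\mathfrak L_\infty(a_0)=\bigcap_{\alpha>1}L_\infty(a_0^\alpha),\qquad \mathfrak L_\infty(a_\infty)=\bigcup_{\alpha>1}L_\infty(a_\infty^\alpha),$$ and let the lower and upper limits of $L_\infty(a^\alpha)$ be the spaces of block matrices $$\underline{\lim}\,L_\infty(a^\alpha)=\begin{pmatrix}\mathfrak L_\infty(a_0)&\underline{\mathfrak L_{0,\infty}}\\ \underline{\mathfrak L_{\infty,0}}&\mathfrak L_\infty(a_\infty)\end{pmatrix},\qquad \overline{\lim}\,L_\infty(a^\alpha)=\begin{pmatrix}\mathfrak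 L_\infty(a_0)&\overline{\mathfrak L_{0,\infty}}\\ \overline{\mathfrak L_{\infty,0}}&\mathfrak L_\infty(a_\infty)\end{pmatrix}$$ with the product topologies. **Theorem.** If $\underline{\mathfrak L_{0,\infty}}=\overline{\mathfrak L_{0,\infty}}$ as sets and their topologies coincide, then $\overline{\lim}\,L_\infty(a^\alpha)=\underline{\lim}\,L_\infty(a^\alpha)$ as sets and with their topologies, and this space $\mathfrak L_\infty(a)$ is an (LF)-space, i.e. a Hausdorff space that is the locally convex inductive limit of an increasing sequence of Fréchet spaces with continuous inclusions. -/

import Mathlib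

noncomputable section

/-! ### Linear subspaces carrying a topology of their own, and their limits -/

/-- A complex linear subspace of `V` together with a topology on it (which is not required to be
the one induced by anything on `V`). Equality means: same set and same topology. -/
structure TopSubspace (V : Type*) [AddCommGroup V] [Module ℂ V] where
  /-- the underlying subspace -/
  carrier : Submodule ℂ V
  /-- the topology on it -/
  top : TopologicalSpace carrier

namespace TopSubspace

variable {V : Type*} [AddCommGroup V] [Module ℂ V]

/-- `X` is contained in `Y` and the inclusion is continuous. -/
def ContinuouslyIncluded (X Y : TopSubspace V) : Prop :=
  ∃ h : X.carrier ≤ Y.carrier, @Continuous _ _ X.top Y.top (Submodule.inclusion h)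

/-- The topology `t` on the complex vector space `E` is a locally convex vector topology. -/
def IsLocallyConvexTopology (E : Type*) [AddCommGroup E] [Module ℂ E] (t : TopologicalSpace E) :
    Prop :=
  @IsTopologicalAddGroup E t _ ∧ @ContinuousSMul ℂ E _ _ t ∧ @LocallyConvexSpace ℝ E _ _ _ _ t

/-- The projective limit (intersection): the space `⋂ i, F i` with the coarsest topology for which
all inclusions into the `F i` are continuous. -/
def projLimit {ι : Type*} (F : ι → TopSubspace V) : TopSubspace V where
  carrier := ⨅ i, (F i).carrier
  top := ⨅ i, TopologicalSpace.induced
    (Submodule.inclusion (iInf_le (fun i => (F i).carrier) i)) (F i).top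

/-- The inductive limit (union) of a directed family: the space `⋃ i, F i` (for a directed family
of subspaces the supremum is the union) with the finest locally convex topology for which all
inclusions of the `F i` are continuous. In Mathlib's order on topologies, the finest topology of a
family is the infimum; an infimum of locally convex topologies with continuous inclusions is again
one. -/
def indLimit {ι : Type*} (F : ι → TopSubspace V) : TopSubspace V where
  carrier := ⨆ i, (F i).carrier
  top := sInf {t | IsLocallyConvexTopology _ t ∧
    ∀ i, @Continuous _ _ (F i).top t
      (Submodule.inclusion (le_iSup (fun i => (F i).carrier) i))}

/-- For a family decreasing in the first and increasing in the second index, the lower limit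
`⋃ β, ⋂ α, F α β`, with its iterated limit topology. -/
def lowerLimit {ι κ : Type*} (F : ι → κ → TopSubspace V) : TopSubspace V :=
  indLimit fun β => projLimit fun α => F α β

/-- For a family decreasing in the first and increasing in the second index, the upper limit
`⋂ α, ⋃ β, F α β`, with its iterated limit topology. -/
def upperLimit {ι κ : Type*} (F : ι → κ → TopSubspace V) : TopSubspace V :=
  projLimit fun α => indLimit fun β => F α β

/-- The space of block matrices whose `(i, j)` entry lies in `X i j`, with the product topology. -/
def block {m n : Type*} (X : m → n → TopSubspace V) : TopSubspace (Matrix m n V) where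
  carrier :=
    { carrier := {s | ∀ i j, s i j ∈ (X i j).carrier}
      add_mem' := fun hs ht i j => add_mem (hs i j) (ht i j)
      zero_mem' := fun i j => zero_mem (X i j).carrier
      smul_mem' := fun c _ hs i j => (X i j).carrier.smul_mem c (hs i j) }
  top := ⨅ i, ⨅ j, TopologicalSpace.induced (fun s => ⟨s.1 i j, s.2 i j⟩) (X i j).top

/-- A Fréchet space: a locally convex, metrizable and complete topological vector space. -/
def IsFrechet (X : TopSubspace V) : Prop :=
  IsLocallyConvexTopology X.carrier X.top ∧
  @TopologicalSpace.MetrizableSpace X.carrier X.top ∧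
  ∃ h : @IsTopologicalAddGroup X.carrier X.top _,
    @CompleteSpace X.carrier (@IsTopologicalAddGroup.rightUniformSpace X.carrier _ X.top h)

/-- An (LF)-space: a Hausdorff space which is the locally convex inductive limit of an increasing
sequence of Fréchet spaces with continuous inclusions. -/
def IsLF (X : TopSubspace V) : Prop :=
  @T2Space X.carrier X.top ∧
  ∃ F : ℕ → TopSubspace V, (∀ n, (F n).IsFrechet) ∧
    (∀ n, (F n).ContinuouslyIncluded (F (n + 1))) ∧ X = indLimit F

/-- For a linear map `φ` on a normed space, the seminorm `s ↦ inf {‖x‖ | φ x = s}` on the range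
of `φ`. If `φ` is injective this is `φ x ↦ ‖x‖`. -/
def rangeSeminorm {E : Type*} [SeminormedAddCommGroup E] [NormedSpace ℂ E] (φ : E →ₗ[ℂ] V) :
    Seminorm ℂ (LinearMap.range φ) :=
  Seminorm.ofSMulLE (fun s => ⨅ x : {x : E // φ x = s}, ‖x.1‖)
    (by
      refine le_antisymm ?_ (Real.iInf_nonneg fun x => norm_nonneg _)
      exact (ciInf_le ⟨0, by rintro _ ⟨x, rfl⟩; exact norm_nonneg _⟩
        (⟨0, by simp⟩ : {x : E // φ x = ((0 : LinearMap.range φ) : V)})).trans (by simp))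
    (by
      intro s t
      have : Nonempty {x : E // φ x = (s : V)} := let ⟨x, hx⟩ := s.2; ⟨⟨x, hx⟩⟩
      have : Nonempty {x : E // φ x = (t : V)} := let ⟨x, hx⟩ := t.2; ⟨⟨x, hx⟩⟩
      refine le_ciInf_add_ciInf fun x y => ?_
      exact (ciInf_le ⟨0, by rintro _ ⟨x, rfl⟩; exact norm_nonneg _⟩
        (⟨x.1 + y.1, by simp [x.2, y.2]⟩ :
          {z : E // φ z = ((s + t : LinearMap.range φ) : V)})).trans (norm_add_le _ _))
    (by
      intro c s
      have : Nonempty {x : E // φ x = (s : V)} := let ⟨x, hx⟩ := s.2; ⟨⟨x, hx⟩⟩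
      rw [Real.mul_iInf_of_nonneg (norm_nonneg c)]
      refine le_ciInf fun x => ?_
      exact (ciInf_le ⟨0, by rintro _ ⟨x, rfl⟩; exact norm_nonneg _⟩
        (⟨c • x.1, by simp [x.2]⟩ :
          {z : E // φ z = ((c • s : LinearMap.range φ) : V)})).trans (norm_smul_le _ _))

/-- The range of a linear map `φ` on a normed space with the topology of `rangeSeminorm φ`. -/
def ofRange {E : Type*} [SeminormedAddCommGroup E] [NormedSpace ℂ E] (φ : E →ₗ[ℂ] V) :
    TopSubspace V where
  carrier := LinearMap.range φ
  top := (rangeSeminorm φ).toSeminormedAddCommGroup.toUniformSpace.toTopologicalSpace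

end TopSubspace

/-! ### Positive selfadjoint operators: affiliation, spectral projections, powers -/

section Operators

variable {H : Type*} [NormedAddCommGroup H] [InnerProductSpace ℂ H] [CompleteSpace H]

/-- The operator `a` is affiliated with `M`: `y a ⊆ a y` for every `y` in the commutant of `M`. -/
def IsAffiliated (a : H →ₗ.[ℂ] H) (M : VonNeumannAlgebra H) : Prop :=
  ∀ y ∈ M.commutant, ∀ f : a.domain, ∃ h : y f ∈ a.domain, a ⟨y f, h⟩ = y (a f)

/-- The operator `a` is positive: `0 ≤ ⟪a f, f⟫` on its domain. -/
def IsPositiveOperator (a : H →ₗ.[ℂ] H) : Prop :=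
  ∀ f : a.domain, 0 ≤ (inner ℂ (f : H) (a f)).re

open Classical in
/-- The bounded operator `R = (1 + a)⁻¹`, i.e. `R h ∈ D(a)` and `R h + a (R h) = h` for all `h`.
It exists, and is unique, for every positive selfadjoint `a`. -/
def shiftInv (a : H →ₗ.[ℂ] H) : H →L[ℂ] H :=
  if h : ∃ R : H →L[ℂ] H, ∀ v : H, ∃ hv : R v ∈ a.domain, R v + a ⟨R v, hv⟩ = v
  then h.choose else 0

/-- The power `a ^ α`, `α > 0`, of a positive selfadjoint operator. With `R = (1 + a)⁻¹` one has
`a = (1 - R) R⁻¹` and, by the functional calculus, `a ^ α = (1 - R) ^ α (R ^ α)⁻¹`, the domain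
being the range of the injective operator `R ^ α`: its graph is
`{(R ^ α h, (1 - R) ^ α h) | h ∈ H}`. -/
def opPow (a : H →ₗ.[ℂ] H) (α : ℝ) : H →ₗ.[ℂ] H :=
  (LinearMap.range (((shiftInv a) ^ α : H →L[ℂ] H).toLinearMap.prod
    ((1 - shiftInv a) ^ α : H →L[ℂ] H).toLinearMap)).toLinearPMap

/-- The spectral projection `χ_[0,l](a)`, `l ≥ 0`, of a positive selfadjoint operator. As
`a > l` iff `(1 + a)⁻¹ < (1 + l)⁻¹`, this is the projection onto the kernel of the positive part of
`(1 + l)⁻¹ - (1 + a)⁻¹`. -/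
def spectralProj (a : H →ₗ.[ℂ] H) (l : ℝ) : H →L[ℂ] H :=
  (cfc (fun t : ℝ => max ((1 + l)⁻¹ - t) 0) (shiftInv a)).ker.starProjection

/-- The operator `a p`, with domain `{f | p f ∈ D(a)}`. -/
def compBounded (a : H →ₗ.[ℂ] H) (p : H →L[ℂ] H) : H →ₗ.[ℂ] H where
  domain := a.domain.comap p.toLinearMap
  toFun := a.toFun.comp (p.toLinearMap.restrict fun _ hf => hf)

/-- The two parts of `a`: `part a 0 = ∫_[0,1] l dP_l = a p₀` and
`part a 1 = ∫_(1,∞) l dP_l = a p_∞`, where `p₀ = χ_[0,1](a)` and `p_∞ = 1 - p₀`.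
The index `1 : Fin 2` thus stands for `∞`. -/
def part (a : H →ₗ.[ℂ] H) : Fin 2 → H →ₗ.[ℂ] H :=
  ![compBounded a (spectralProj a 1), compBounded a (1 - spectralProj a 1)]

/-! ### Spaces of sesquilinear forms -/

/-- The common (dense) domain of all powers of `a₀` and `a_∞`. It is a core of each of them, so
that a form `(f, g) ↦ ⟪x b f, c g⟫` with `b`, `c` such powers and `x` bounded is determined on its
full domain `D(b) × D(c)` by its restriction to the common domain. -/
def commonDomain (a : H →ₗ.[ℂ] H) : Submodule ℂ H :=
  ⨅ i : Fin 2, ⨅ α : Set.Ioi (0 : ℝ), (opPow (part a i) α).domain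

/-- Sesquilinear forms `s f g` on the common domain, linear in `f` and conjugate linear in `g`. -/
abbrev SesqForm (a : H →ₗ.[ℂ] H) : Type _ :=
  commonDomain a →ₗ[ℂ] commonDomain a →ₗ⋆[ℂ] ℂ

/-- The restriction of `a₀ ^ α` (`i = 0`) or `a_∞ ^ α` (`i = 1`) to the common domain. -/
def powOn (a : H →ₗ.[ℂ] H) (i : Fin 2) (α : Set.Ioi (0 : ℝ)) : commonDomain a →ₗ[ℂ] H :=
  (opPow (part a i) α).toFun.comp
    (Submodule.inclusion ((iInf_le _ i).trans (iInf_le _ α)))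

/-- The linear map taking `x ∈ M` to the form `(f, g) ↦ ⟨x b f, c g⟩`, `b = a_j ^ β`,
`c = a_i ^ α`, where `⟨·,·⟩` is linear in its first variable. -/
def formMap (M : VonNeumannAlgebra H) (a : H →ₗ.[ℂ] H) (i j : Fin 2) (α β : Set.Ioi (0 : ℝ)) :
    M.toStarSubalgebra.toSubalgebra.toSubmodule →ₗ[ℂ] SesqForm a :=
  LinearMap.mk₂'ₛₗ (RingHom.id ℂ) (RingHom.id ℂ)
    (fun x f => ((innerₛₗ ℂ).flip (x.1 (powOn a j β f))).comp (powOn a i α))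
    (fun x y f => by ext g; simp)
    (fun c x f => by ext g; simp)
    (fun x f f' => by ext g; simp)
    (fun c x f => by ext g; simp)

/-- The space `S_{a_i ^ α, a_j ^ β}(M)` of the forms `(f, g) ↦ ⟨x a_j ^ β f, a_i ^ α g⟩`, `x ∈ M`,
with the topology of the norm `inf ‖x‖`, the infimum being taken over all `x ∈ M` that represent the
form (it equals `‖p_i x p_j‖` when `a` is injective). -/
def formSpace (M : VonNeumannAlgebra H) (a : H →ₗ.[ℂ] H) (i j : Fin 2) (α β : Set.Ioi (0 : ℝ)) :
    TopSubspace (SesqForm a) :=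
  TopSubspace.ofRange (formMap M a i j α β)

/-- `L_∞(a₀ ^ α)` (`i = 0`) or `L_∞(a_∞ ^ α)` (`i = 1`) for `α > 1`, as the space of forms
`(f, g) ↦ ⟨x a_i ^ (α / 2) f, a_i ^ (α / 2) g⟩`, `x ∈ M`. -/
def diagSpace (M : VonNeumannAlgebra H) (a : H →ₗ.[ℂ] H) (i : Fin 2) (α : Set.Ioi (1 : ℝ)) :
    TopSubspace (SesqForm a) :=
  have h : (α / 2 : ℝ) ∈ Set.Ioi 0 := half_pos (zero_lt_one.trans (Set.mem_Ioi.mp α.2))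
  formSpace M a i i ⟨α / 2, h⟩ ⟨α / 2, h⟩

/-- The family `S_{0,∞}^{α,β} = S_{a₀ ^ α, a_∞ ^ β}(M)`; decreasing in `α`, increasing in `β`. -/
def family01 (M : VonNeumannAlgebra H) (a : H →ₗ.[ℂ] H) (α β : Set.Ioi (0 : ℝ)) :
    TopSubspace (SesqForm a) :=
  formSpace M a 0 1 α β

/-- The family `S_{∞,0}^{β,α} = S_{a_∞ ^ β, a₀ ^ α}(M)`; decreasing in `α`, increasing in `β`,
where as before `α` is the exponent of `a₀` and `β` that of `a_∞`. -/
def family10 (M : VonNeumannAlgebra H) (a : H →ₗ.[ℂ] H) (α β : Set.Ioi (0 : ℝ)) :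
    TopSubspace (SesqForm a) :=
  formSpace M a 1 0 β α

/-- The lower limit of the spaces `L_∞(a ^ α)`, as a space of `2 × 2` block matrices of forms. -/
def lowerLimLinfty (M : VonNeumannAlgebra H) (a : H →ₗ.[ℂ] H) :
    TopSubspace (Matrix (Fin 2) (Fin 2) (SesqForm a)) :=
  TopSubspace.block
    ![![TopSubspace.projLimit (diagSpace M a 0), TopSubspace.lowerLimit (family01 M a)],
      ![TopSubspace.lowerLimit (family10 M a), TopSubspace.indLimit (diagSpace M a 1)]]

/-- The upper limit of the spaces `L_∞(a ^ α)`, as a space of `2 × 2` block matrices of forms. -/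
def upperLimLinfty (M : VonNeumannAlgebra H) (a : H →ₗ.[ℂ] H) :
    TopSubspace (Matrix (Fin 2) (Fin 2) (SesqForm a)) :=
  TopSubspace.block
    ![![TopSubspace.projLimit (diagSpace M a 0), TopSubspace.upperLimit (family01 M a)],
      ![TopSubspace.upperLimit (family10 M a), TopSubspace.indLimit (diagSpace M a 1)]]

end Operators

end

/-! Equality of the two limits concerns only the off-diagonal corners. The adjoint of a form, s*(f,
g) = conj s(g, f), is a conjugate-linear involution; replacing x by x* shows that it identifies
S_{0,∞}^{α,β} with S_{∞,0}^{β,α}, topology included (`formSpace_eq_comap_adjoint`). Pulling back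
along an involution is an order isomorphism for continuous inclusion, so it commutes with unions and
intersections, and coincidence in one corner gives coincidence in the other.

For the (LF) property of the lower limit, each S_{i,j}^{α,β} is a quotient of the Banach space M by
a norm-closed subspace, hence Fréchet. The resolvent (1 + a_i)⁻¹ has spectrum in [1/2, 1] for a₀ and
in [0, 1/2] ∪ {1} for a_∞. By functional calculus, larger powers of a₀ and smaller powers of a_∞ are
therefore multiples, by elements of M, of the other powers (`powOn_zero_of_le`, `powOn_one_of_le`).
So the families are monotone, and the real exponents may be replaced by sequences. A decreasing
sequence of Fréchet spaces has a Fréchet intersection, so each corner is the inductive limit of an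
increasing sequence of Fréchet spaces, and finite block matrices commute with inductive limits
(`block_indLimit`). The limit is Hausdorff because the evaluations s ↦ s(f, g) of the entries are
continuous and separate points. -/

noncomputable section

namespace TopSubspace

variable {V W : Type*} [AddCommGroup V] [Module ℂ V] [AddCommGroup W] [Module ℂ W]

/-! ### Continuous inclusion as a partial order -/

theorem ContinuouslyIncluded.antisymm {X Y : TopSubspace V} (h : X.ContinuouslyIncluded Y)
    (h' : Y.ContinuouslyIncluded X) : X = Y := by
  obtain ⟨C, t⟩ := X
  obtain ⟨D, u⟩ := Y
  obtain ⟨h₁, c₁⟩ := h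
  obtain ⟨h₂, c₂⟩ := h'
  obtain rfl : C = D := le_antisymm h₁ h₂
  congr 1
  exact le_antisymm (continuous_id_iff_le.mp c₁) (continuous_id_iff_le.mp c₂)

/-- With this order, equality of sets and topologies is proved by antisymmetry, and the limits are
handled through their universal properties. -/
instance : PartialOrder (TopSubspace V) where
  le := ContinuouslyIncluded
  le_refl X := ⟨le_rfl, @continuous_id _ X.top⟩
  le_trans X Y Z h h' := ⟨h.1.trans h'.1, by
    let := X.top; let := Y.top; let := Z.top
    exact h'.2.comp h.2⟩
  le_antisymm _ _ := ContinuouslyIncluded.antisymm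

theorem le_def {X Y : TopSubspace V} : X ≤ Y ↔ ∃ h : X.carrier ≤ Y.carrier,
    @Continuous _ _ X.top Y.top (Submodule.inclusion h) := Iff.rfl

/-- The preimage of `Z` under a semilinear map, with the induced topology. -/
def comap {σ : ℂ →+* ℂ} (L : V →ₛₗ[σ] W) (Z : TopSubspace W) : TopSubspace V where
  carrier := Z.carrier.comap L
  top := TopologicalSpace.induced (fun v => ⟨L v, v.2⟩) Z.top

/-- Continuity of a map from `X` to `Z` becomes an inequality. Semilinear maps are allowed because
the adjoint of forms is conjugate linear. -/
theorem le_comap_iff {σ : ℂ →+* ℂ} {L : V →ₛₗ[σ] W} {X : TopSubspace V} {Z : TopSubspace W} :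
    X ≤ comap L Z ↔ ∃ h : ∀ v ∈ X.carrier, L v ∈ Z.carrier,
      @Continuous _ _ X.top Z.top (fun v => ⟨L v, h v v.2⟩) := by
  refine exists_congr fun h => ?_
  let := X.top; let := Z.top
  exact continuous_induced_rng

theorem comap_mono {σ : ℂ →+* ℂ} (L : V →ₛₗ[σ] W) : Monotone (comap L) := by
  intro Y Z h
  obtain ⟨h₁, c₁⟩ := le_comap_iff.mp (le_refl (comap L Y))
  let := (comap L Y).top; let := Y.top; let := Z.top
  exact le_comap_iff.mpr ⟨fun v hv => h.1 (h₁ v hv), h.2.comp c₁⟩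

theorem comap_id (X : TopSubspace V) : comap LinearMap.id X = X := by
  obtain ⟨h, c⟩ := le_comap_iff.mp (le_refl (comap LinearMap.id X))
  exact le_antisymm (le_def.mpr ⟨h, c⟩) (le_comap_iff.mpr ⟨fun v hv => hv, @continuous_id _ X.top⟩)

theorem comap_comap_of_involutive {σ : ℂ →+* ℂ} {J : V →ₛₗ[σ] V} (hJ : ∀ v, J (J v) = v)
    (X : TopSubspace V) : comap J (comap J X) = X := by
  refine le_antisymm ?_ ?_
  · obtain ⟨h₁, c₁⟩ := le_comap_iff.mp (le_refl (comap J (comap J X)))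
    obtain ⟨h₂, c₂⟩ := le_comap_iff.mp (le_refl (comap J X))
    let := (comap J (comap J X)).top; let := (comap J X).top; let := X.top
    refine ⟨fun v hv => by simpa [hJ] using h₂ _ (h₁ v hv), ?_⟩
    convert! c₂.comp c₁ using 1
    funext v
    exact Subtype.ext (hJ v).symm
  · let := (comap J X).top; let := X.top
    have hX : ∀ v ∈ X.carrier, J v ∈ (comap J X).carrier := fun v hv => by
      change J (J v) ∈ X.carrier
      rwa [hJ]
    refine le_comap_iff.mpr ⟨hX, continuous_induced_rng.mpr ?_⟩
    convert! continuous_id using 1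
    funext v
    exact Subtype.ext (hJ v)

/-- Pullback along an involution is its own inverse and monotone, hence an order isomorphism. This
is what makes it commute with both limits. -/
theorem comap_le_iff_of_involutive {σ : ℂ →+* ℂ} {J : V →ₛₗ[σ] V} (hJ : ∀ v, J (J v) = v)
    {X Y : TopSubspace V} : comap J X ≤ Y ↔ X ≤ comap J Y :=
  ⟨fun h => by simpa only [comap_comap_of_involutive hJ] using comap_mono J h,
    fun h => by simpa only [comap_comap_of_involutive hJ] using comap_mono J h⟩

/-! ### Locally convex topologies -/

theorem IsLocallyConvexTopology.induced {E F : Type*} [AddCommGroup E] [Module ℂ E]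
    [AddCommGroup F] [Module ℂ F] {t : TopologicalSpace F} (h : IsLocallyConvexTopology F t)
    {σ : ℂ →+* ℂ} (hσ : Continuous σ) (L : E →ₛₗ[σ] F) :
    IsLocallyConvexTopology E (t.induced L) := by
  obtain ⟨_, _, _⟩ := h
  let : TopologicalSpace E := t.induced L
  refine ⟨topologicalAddGroup_induced L, continuousSMul_inducedₛₗ L hσ, ?_⟩
  -- A continuous ring endomorphism of ℂ fixes the reals, so `L` is real linear, which suffices for
  -- local convexity.
  let L' : E →ₗ[ℝ] F :=
    { toFun := L
      map_add' := map_add L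
      map_smul' := fun r x => by
        have : σ r = r := by simpa using map_real_smul σ hσ r 1
        simp [← Complex.coe_smul, this] }
  exact LocallyConvexSpace.induced L'

theorem IsLocallyConvexTopology.sInf {E : Type*} [AddCommGroup E] [Module ℂ E]
    {T : Set (TopologicalSpace E)} (h : ∀ t ∈ T, IsLocallyConvexTopology E t) :
    IsLocallyConvexTopology E (sInf T) :=
  ⟨topologicalAddGroup_sInf fun t ht => (h t ht).1,
    @continuousSMul_sInf _ _ _ _ _ fun t ht => (h t ht).2.1,
    LocallyConvexSpace.sInf fun t ht => (h t ht).2.2⟩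

theorem IsLocallyConvexTopology.iInf {E ι : Type*} [AddCommGroup E] [Module ℂ E]
    {t : ι → TopologicalSpace E} (h : ∀ i, IsLocallyConvexTopology E (t i)) :
    IsLocallyConvexTopology E (⨅ i, t i) :=
  .sInf <| Set.forall_mem_range.mpr h

/-- The restriction of a semilinear map to `comap L Z`, as a map into `Z`. -/
def comapMap {σ : ℂ →+* ℂ} (L : V →ₛₗ[σ] W) (Z : TopSubspace W) :
    (comap L Z).carrier →ₛₗ[σ] Z.carrier where
  toFun v := ⟨L v, v.2⟩
  map_add' v w := Subtype.ext (map_add L v.1 w.1)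
  map_smul' c v := Subtype.ext (map_smulₛₗ L c v.1)

/-- The topology of `X` is a locally convex vector topology. -/
def IsLocallyConvex (X : TopSubspace V) : Prop := IsLocallyConvexTopology X.carrier X.top

theorem IsLocallyConvex.comap {σ : ℂ →+* ℂ} (hσ : Continuous σ) (L : V →ₛₗ[σ] W)
    {Z : TopSubspace W} (h : Z.IsLocallyConvex) : (comap L Z).IsLocallyConvex :=
  IsLocallyConvexTopology.induced h hσ (comapMap L Z)

/-! ### Limits -/

theorem le_projLimit_iff {ι : Type*} {F : ι → TopSubspace V} {X : TopSubspace V} :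
    X ≤ projLimit F ↔ ∀ i, X ≤ F i := by
  simp only [le_def]
  let := X.top
  refine ⟨fun ⟨h, c⟩ i => ⟨h.trans (iInf_le _ i), ?_⟩, fun h => ⟨le_iInf fun i => (h i).1, ?_⟩⟩
  · let := (F i).top
    have : Continuous (Submodule.inclusion (iInf_le (fun i => (F i).carrier) i) ∘
        Submodule.inclusion h) := continuous_induced_rng.mp (continuous_iInf_rng.mp c i)
    exact this
  · refine continuous_iInf_rng.mpr fun i => ?_
    let := (F i).top
    exact continuous_induced_rng.mpr (h i).2

theorem projLimit_le {ι : Type*} (F : ι → TopSubspace V) (i : ι) : projLimit F ≤ F i :=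
  le_projLimit_iff.mp le_rfl i

theorem projLimit_isLocallyConvex {ι : Type*} {F : ι → TopSubspace V}
    (h : ∀ i, (F i).IsLocallyConvex) : (projLimit F).IsLocallyConvex :=
  IsLocallyConvexTopology.iInf fun i => (h i).induced (σ := RingHom.id ℂ) continuous_id _

theorem indLimit_isLocallyConvex {ι : Type*} (F : ι → TopSubspace V) :
    (indLimit F).IsLocallyConvex :=
  IsLocallyConvexTopology.sInf fun _ ht => ht.1

theorem le_indLimit {ι : Type*} (F : ι → TopSubspace V) (i : ι) : F i ≤ indLimit F :=
  ⟨le_iSup (fun i => (F i).carrier) i, by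
    let := (F i).top
    exact continuous_sInf_rng.mpr fun t ht => ht.2 i⟩

/-- The topology induced from `Z` on the union is one of the locally convex topologies over which
the infimum is taken. -/
theorem indLimit_le_iff {ι : Type*} {F : ι → TopSubspace V} {Z : TopSubspace V}
    (hZ : Z.IsLocallyConvex) : indLimit F ≤ Z ↔ ∀ i, F i ≤ Z := by
  refine ⟨fun h i => (le_indLimit F i).trans h, fun h => ?_⟩
  have hc : (indLimit F).carrier ≤ Z.carrier := iSup_le fun i => (h i).1
  refine ⟨hc, continuous_iff_le_induced.mpr (sInf_le ⟨?_, fun i => ?_⟩)⟩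
  · exact hZ.induced (σ := RingHom.id ℂ) continuous_id (Submodule.inclusion hc)
  · let := (F i).top; let := Z.top
    exact continuous_induced_rng.mpr (h i).2

theorem projLimit_eq_of_coinitial {ι κ : Type*} {F : ι → TopSubspace V} {G : κ → TopSubspace V}
    (h : ∀ i, ∃ k, G k ≤ F i) (h' : ∀ k, ∃ i, F i ≤ G k) : projLimit F = projLimit G :=
  le_antisymm
    (le_projLimit_iff.mpr fun k => let ⟨i, hi⟩ := h' k; (projLimit_le F i).trans hi)
    (le_projLimit_iff.mpr fun i => let ⟨k, hk⟩ := h i; (projLimit_le G k).trans hk)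

theorem indLimit_eq_of_cofinal {ι κ : Type*} {F : ι → TopSubspace V} {G : κ → TopSubspace V}
    (h : ∀ i, ∃ k, F i ≤ G k) (h' : ∀ k, ∃ i, G k ≤ F i) : indLimit F = indLimit G :=
  le_antisymm
    ((indLimit_le_iff (indLimit_isLocallyConvex G)).mpr fun i =>
      let ⟨k, hk⟩ := h i; hk.trans (le_indLimit G k))
    ((indLimit_le_iff (indLimit_isLocallyConvex F)).mpr fun k =>
      let ⟨i, hi⟩ := h' k; hi.trans (le_indLimit F i))

theorem projLimit_mono {ι : Type*} {F G : ι → TopSubspace V} (h : ∀ i, F i ≤ G i) :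
    projLimit F ≤ projLimit G :=
  le_projLimit_iff.mpr fun i => (projLimit_le F i).trans (h i)

theorem indLimit_const {ι : Type*} [Nonempty ι] {X : TopSubspace V} (hX : X.IsLocallyConvex) :
    indLimit (fun _ : ι => X) = X :=
  le_antisymm ((indLimit_le_iff hX).mpr fun _ => le_rfl)
    (le_indLimit (fun _ : ι => X) (Classical.arbitrary ι))

section Involution

variable {σ : ℂ →+* ℂ} {J : V →ₛₗ[σ] V} {ι κ : Type*}

theorem comap_projLimit (hJ : ∀ v, J (J v) = v) (F : ι → TopSubspace V) :
    comap J (projLimit F) = projLimit fun i => comap J (F i) :=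
  eq_of_forall_le_iff fun X => by
    simp only [← comap_le_iff_of_involutive hJ, le_projLimit_iff]

theorem comap_indLimit (hσ : Continuous σ) (hJ : ∀ v, J (J v) = v) (F : ι → TopSubspace V) :
    comap J (indLimit F) = indLimit fun i => comap J (F i) := by
  refine le_antisymm ?_ ?_
  · rw [comap_le_iff_of_involutive hJ,
      indLimit_le_iff ((indLimit_isLocallyConvex _).comap hσ J)]
    intro i
    rw [← comap_le_iff_of_involutive hJ]
    exact le_indLimit (fun i => comap J (F i)) i
  · rw [indLimit_le_iff ((indLimit_isLocallyConvex _).comap hσ J)]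
    exact fun i => comap_mono J (le_indLimit F i)

theorem comap_lowerLimit (hσ : Continuous σ) (hJ : ∀ v, J (J v) = v)
    (F : ι → κ → TopSubspace V) :
    comap J (lowerLimit F) = lowerLimit fun i k => comap J (F i k) := by
  simp only [lowerLimit, comap_indLimit hσ hJ, comap_projLimit hJ]

theorem comap_upperLimit (hσ : Continuous σ) (hJ : ∀ v, J (J v) = v)
    (F : ι → κ → TopSubspace V) :
    comap J (upperLimit F) = upperLimit fun i k => comap J (F i k) := by
  simp only [upperLimit, comap_indLimit hσ hJ, comap_projLimit hJ]

end Involution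

/-! ### Block matrices -/

section Block

variable {m n : Type*}

theorem le_block_iff {X : TopSubspace (Matrix m n V)} {Y : m → n → TopSubspace V} :
    X ≤ block Y ↔ ∀ i j, X ≤ comap (Matrix.entryLinearMap ℂ V i j) (Y i j) := by
  simp only [le_comap_iff]
  let := X.top
  constructor
  · rintro ⟨h, c⟩ i j
    let := (Y i j).top
    exact ⟨fun v hv => h hv i j,
      continuous_induced_rng.mp (continuous_iInf_rng.mp (continuous_iInf_rng.mp c i) j)⟩
  · refine fun h => ⟨fun v hv i j => (h i j).1 v hv,
      continuous_iInf_rng.mpr fun i => continuous_iInf_rng.mpr fun j => ?_⟩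
    let := (Y i j).top
    exact continuous_induced_rng.mpr (h i j).2

theorem block_le_comap (Y : m → n → TopSubspace V) (i : m) (j : n) :
    block Y ≤ comap (Matrix.entryLinearMap ℂ V i j) (Y i j) :=
  le_block_iff.mp le_rfl i j

theorem block_mono {Y Z : m → n → TopSubspace V} (h : ∀ i j, Y i j ≤ Z i j) :
    block Y ≤ block Z :=
  le_block_iff.mpr fun i j => (block_le_comap Y i j).trans (comap_mono _ (h i j))

theorem block_eq_projLimit (Y : m → n → TopSubspace V) :
    block Y = projLimit fun k : m × n => comap (Matrix.entryLinearMap ℂ V k.1 k.2) (Y k.1 k.2) :=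
  eq_of_forall_le_iff fun X => by simp only [le_block_iff, le_projLimit_iff, Prod.forall]

theorem le_comap_comp {U : Type*} [AddCommGroup U] [Module ℂ U] {σ τ ρ : ℂ →+* ℂ}
    [RingHomCompTriple σ τ ρ]
    {K : U →ₛₗ[σ] V} {L : V →ₛₗ[τ] W} {X : TopSubspace U} {Y : TopSubspace V} {Z : TopSubspace W}
    (h : X ≤ comap K Y) (h' : Y ≤ comap L Z) : X ≤ comap (L.comp K) Z := by
  obtain ⟨h₁, c₁⟩ := le_comap_iff.mp h
  obtain ⟨h₂, c₂⟩ := le_comap_iff.mp h'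
  let := X.top; let := Y.top; let := Z.top
  exact le_comap_iff.mpr ⟨fun v hv => h₂ _ (h₁ v hv), c₂.comp c₁⟩

theorem le_comap_zero {X : TopSubspace V} {Z : TopSubspace W} :
    X ≤ comap (0 : V →ₗ[ℂ] W) Z := by
  let := X.top; let := Z.top
  exact le_comap_iff.mpr ⟨fun _ _ => zero_mem _, continuous_const (y := 0)⟩

theorem le_comap_sum {ι : Type*} {s : Finset ι} {L : ι → V →ₗ[ℂ] W} {X : TopSubspace V}
    {Z : TopSubspace W} (hZ : Z.IsLocallyConvex) (h : ∀ i ∈ s, X ≤ comap (L i) Z) :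
    X ≤ comap (∑ i ∈ s, L i) Z := by
  classical
  induction s using Finset.induction_on with
  | empty => exact le_comap_zero
  | insert i s hi ih =>
    obtain ⟨h₁, c₁⟩ := le_comap_iff.mp (h i (by simp))
    obtain ⟨h₂, c₂⟩ := le_comap_iff.mp (ih fun j hj => h j (by simp [hj]))
    let := X.top; let := Z.top
    have : IsTopologicalAddGroup Z.carrier := hZ.1
    rw [Finset.sum_insert hi]
    exact le_comap_iff.mpr ⟨fun v hv => add_mem (h₁ v hv) (h₂ v hv), c₁.add c₂⟩

/-- A finite matrix is the sum of its entries, each placed in an otherwise zero matrix. Every such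
placement is continuous into the limit of blocks, and a finite sum of continuous maps into a
topological group is continuous. -/
theorem block_indLimit {ι : Type*} [Finite m] [Finite n] (F : m → n → ι → TopSubspace V) :
    block (fun i j => indLimit (F i j)) = indLimit fun k => block fun i j => F i j k := by
  classical
  cases nonempty_fintype m
  cases nonempty_fintype n
  have hZ := indLimit_isLocallyConvex fun k => block fun i j => F i j k
  set Z := indLimit fun k => block fun i j => F i j k
  have hB : (block fun i j => indLimit (F i j)).IsLocallyConvex := by
    rw [block_eq_projLimit]
    exact projLimit_isLocallyConvex fun k =>
      (indLimit_isLocallyConvex _).comap (σ := RingHom.id ℂ) continuous_id _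
  refine le_antisymm ?_
    ((indLimit_le_iff hB).mpr fun k => block_mono fun i j => le_indLimit (F i j) k)
  have hs (i : m) (j : n) : indLimit (F i j) ≤ comap (Matrix.singleLinearMap ℂ i j) Z := by
    rw [indLimit_le_iff (hZ.comap (σ := RingHom.id ℂ) continuous_id _)]
    intro k
    refine le_trans ?_ (comap_mono _ (le_indLimit (fun k => block fun i j => F i j k) k))
    -- Placing at (i, j) and reading at (p, q) is the identity or zero.
    have (p : m) (q : n) : F i j k ≤ comap ((Matrix.entryLinearMap ℂ V p q).comp
        (Matrix.singleLinearMap ℂ i j)) (F p q k) := by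
      by_cases h : i = p ∧ j = q
      · obtain ⟨rfl, rfl⟩ := h
        have : (Matrix.entryLinearMap ℂ V i j).comp (Matrix.singleLinearMap ℂ i j) =
            LinearMap.id := by ext v; simp
        rw [this, comap_id]
      · have : (Matrix.entryLinearMap ℂ V p q).comp (Matrix.singleLinearMap ℂ i j) = 0 := by
          ext v; simp [h]
        rw [this]
        exact le_comap_zero
    choose h₁ c₁ using fun p q => le_comap_iff.mp (this p q)
    refine le_comap_iff.mpr ⟨fun v hv p q => h₁ p q v hv, ?_⟩
    let := (F i j k).top
    refine continuous_iInf_rng.mpr fun p => continuous_iInf_rng.mpr fun q => ?_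
    let := (F p q k).top
    exact continuous_induced_rng.mpr (c₁ p q)
  have key := le_comap_sum (s := (Finset.univ : Finset (m × n))) hZ fun k _ =>
    le_comap_comp (block_le_comap (fun i j => indLimit (F i j)) k.1 k.2) (hs k.1 k.2)
  have : ∑ k : m × n, (Matrix.singleLinearMap ℂ k.1 k.2).comp
      (Matrix.entryLinearMap ℂ V k.1 k.2) = LinearMap.id := by
    ext A p q
    simp [LinearMap.sum_apply, Fintype.sum_prod_type, ← Matrix.matrix_eq_sum_single]
  rwa [this, comap_id] at key

end Block

end TopSubspace

namespace TopSubspace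

open Filter Topology

variable {V W : Type*} [AddCommGroup V] [Module ℂ V] [AddCommGroup W] [Module ℂ W]

/-! ### Fréchet spaces -/

/-- Every filter on `E` that is Cauchy for the group topology `t` converges. -/
def CauchyFiltersConverge (E : Type*) [AddCommGroup E] (t : TopologicalSpace E) : Prop :=
  ∀ f : Filter E, f.NeBot → Tendsto (fun p : E × E => p.2 - p.1) (f ×ˢ f) (@nhds E t 0) →
    ∃ x, f ≤ @nhds E t x

theorem completeSpace_iff_cauchyFiltersConverge {E : Type*} [AddCommGroup E]
    (t : TopologicalSpace E) (h : @IsTopologicalAddGroup E t _) :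
    @CompleteSpace E (@IsTopologicalAddGroup.rightUniformSpace E _ t h) ↔
      CauchyFiltersConverge E t := by
  let := @IsTopologicalAddGroup.rightUniformSpace E _ t h
  have key (f : Filter E) : Cauchy f ↔ f.NeBot ∧
      Tendsto (fun p : E × E => p.2 - p.1) (f ×ˢ f) (@nhds E t 0) := by
    simp_rw [sub_eq_add_neg]
    exact and_congr_right fun _ => tendsto_iff_comap.symm
  exact ⟨fun hc f hf hf' => hc.complete ((key f).mpr ⟨hf, hf'⟩),
    fun hc => ⟨fun {f} hf => hc f ((key f).mp hf).1 ((key f).mp hf).2⟩⟩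

/-- A Fréchet topology, described without uniform structures. -/
structure IsFrechetTopology (E : Type*) [AddCommGroup E] [Module ℂ E] (t : TopologicalSpace E) :
    Prop where
  locallyConvex : IsLocallyConvexTopology E t
  t2 : @T2Space E t
  countable : (@nhds E t 0).IsCountablyGenerated
  complete : CauchyFiltersConverge E t

theorem isFrechet_iff {X : TopSubspace V} :
    X.IsFrechet ↔ IsFrechetTopology X.carrier X.top := by
  let := X.top
  constructor
  · rintro ⟨h, _, h', hc⟩
    exact ⟨h, inferInstance, inferInstance,
      (completeSpace_iff_cauchyFiltersConverge _ h').mp hc⟩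
  · rintro ⟨h, _, _, hc⟩
    have h' : IsTopologicalAddGroup X.carrier := h.1
    refine ⟨h, ?_, h', (completeSpace_iff_cauchyFiltersConverge _ h').mpr hc⟩
    let u := IsTopologicalAddGroup.rightUniformSpace X.carrier
    have : IsUniformAddGroup X.carrier := isUniformAddGroup_of_addCommGroup
    have : (uniformity X.carrier).IsCountablyGenerated :=
      IsUniformAddGroup.uniformity_countably_generated
    exact UniformSpace.metrizableSpace

/-- A countable initial topology of Fréchet topologies is a Fréchet topology, provided that any
family of simultaneous limits comes from a point. -/
theorem IsFrechetTopology.iInf_induced {E ι : Type*} [Countable ι] [AddCommGroup E] [Module ℂ E]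
    {F : ι → Type*} [∀ i, AddCommGroup (F i)] [∀ i, Module ℂ (F i)]
    {t : ∀ i, TopologicalSpace (F i)} (h : ∀ i, IsFrechetTopology (F i) (t i))
    (e : ∀ i, E →ₗ[ℂ] F i) (he : ∀ x y, (∀ i, e i x = e i y) → x = y)
    (hlim : ∀ (f : Filter E) (y : ∀ i, F i), f.NeBot → (∀ i, Tendsto (e i) f (𝓝 (y i))) →
      ∃ x, ∀ i, e i x = y i) :
    IsFrechetTopology E (⨅ i, (t i).induced (e i)) := by
  have hnhds (x : E) : @nhds E (⨅ i, (t i).induced (e i)) x = ⨅ i, Filter.comap (e i) (𝓝 (e i x)) := by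
    simp only [nhds_iInf, nhds_induced]
  have hT2 (i : ι) : T2Space (F i) := (h i).t2
  refine ⟨.iInf fun i => (h i).locallyConvex.induced (σ := RingHom.id ℂ) continuous_id _, ?_,
    ?_, ?_⟩
  · let := ⨅ i, (t i).induced (e i)
    have hc (i : ι) : Continuous (e i) := continuous_iInf_dom continuous_induced_dom
    refine ⟨fun x y hxy => ?_⟩
    obtain ⟨i, hi⟩ : ∃ i, e i x ≠ e i y := by
      by_contra! hcon
      exact hxy (he x y hcon)
    exact separated_by_continuous (hc i) hi
  · rw [hnhds]
    have hcount (i : ι) : (Filter.comap (e i) (𝓝 (e i 0))).IsCountablyGenerated := by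
      rw [map_zero]
      have := (h i).countable
      infer_instance
    infer_instance
  · intro f hf hcauchy
    -- The image of a Cauchy filter in each factor is Cauchy, so it converges there; `hlim` glues
    -- these limits to a single point.
    have hlim' (i : ι) : ∃ y, Tendsto (e i) f (𝓝 y) := by
      refine (h i).complete (map (e i) f) inferInstance ?_
      rw [prod_map_map_eq, tendsto_map'_iff]
      rw [hnhds, tendsto_iInf] at hcauchy
      simpa [Function.comp_def] using tendsto_comap_iff.mp (hcauchy i)
    choose y hy using hlim'
    obtain ⟨x, hx⟩ := hlim f y hf hy
    refine ⟨x, ?_⟩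
    rw [hnhds]
    exact le_iInf fun i => by rw [hx]; exact tendsto_iff_comap.mp (hy i)

theorem IsFrechet.isLocallyConvex {X : TopSubspace V} (h : X.IsFrechet) : X.IsLocallyConvex := h.1

theorem IsFrechet.t2Space {X : TopSubspace V} (h : X.IsFrechet) : @T2Space X.carrier X.top :=
  (isFrechet_iff.mp h).t2

theorem IsFrechet.projLimit {F : ℕ → TopSubspace V} (h : ∀ n, (F n).IsFrechet)
    (hF : Antitone F) : (projLimit F).IsFrechet := by
  refine isFrechet_iff.mpr (IsFrechetTopology.iInf_induced (fun n => isFrechet_iff.mp (h n))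
    (fun n => Submodule.inclusion (iInf_le (fun n => (F n).carrier) n))
    (fun x y hxy => Submodule.inclusion_injective _ (hxy 0)) fun f y hf hy => ?_)
  -- Limits in `F n` and in `F 0` agree, as the inclusion is continuous and `F 0` is Hausdorff. The
  -- common limit thus lies in the intersection.
  have hy' (n : ℕ) : ((y n : (F n).carrier) : V) = y 0 := by
    obtain ⟨hle, hc⟩ := le_def.mp (hF n.zero_le)
    let := (F n).top; let := (F 0).top
    have : T2Space (F 0).carrier := (h 0).t2Space
    have := tendsto_nhds_unique ((hc.tendsto (y n)).comp (hy n)) (hy 0)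
    exact congrArg Subtype.val this
  refine ⟨⟨y 0, (Submodule.mem_iInf _).mpr fun n => hy' n ▸ (y n).2⟩, fun n => ?_⟩
  exact Subtype.ext (hy' n).symm

theorem IsFrechet.block {m n : Type*} [Countable m] [Countable n] {X : m → n → TopSubspace V}
    (h : ∀ i j, (X i j).IsFrechet) : (block X).IsFrechet := by
  let E := (TopSubspace.block X).carrier
  let F (k : m × n) := (X k.1 k.2).carrier
  let t (k : m × n) : TopologicalSpace (F k) := (X k.1 k.2).top
  let e (k : m × n) : E →ₗ[ℂ] F k :=
    { toFun := fun s => ⟨s.1 k.1 k.2, s.2 k.1 k.2⟩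
      map_add' := fun _ _ => rfl
      map_smul' := fun _ _ => rfl }
  have hF (k : m × n) : IsFrechetTopology (F k) (t k) := isFrechet_iff.mp (h k.1 k.2)
  have key : IsFrechetTopology E (⨅ k : m × n, (t k).induced (e k)) := by
    refine IsFrechetTopology.iInf_induced hF e ?_ ?_
    · intro s s' hs
      refine Subtype.ext (Matrix.ext fun i j => ?_)
      exact congrArg Subtype.val (hs (i, j))
    · intro f y _ _
      exact ⟨⟨Matrix.of fun i j => (y (i, j)).1, fun i j => (y (i, j)).2⟩, fun k => rfl⟩
  rw [iInf_prod] at key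
  exact isFrechet_iff.mpr key

/-! ### Spaces normed by a quotient norm -/

section OfRange

variable {E : Type*} [SeminormedAddCommGroup E] [NormedSpace ℂ E]

theorem isFrechetTopology_of_normedSpace (E : Type*) [NormedAddCommGroup E] [NormedSpace ℂ E]
    [CompleteSpace E] : IsFrechetTopology E inferInstance := by
  refine ⟨⟨inferInstance, inferInstance, ?_⟩, inferInstance, inferInstance, ?_⟩
  · let : NormedSpace ℝ E := NormedSpace.complexToReal
    exact NormedSpace.toLocallyConvexSpace
  · rw [← completeSpace_iff_cauchyFiltersConverge _ inferInstance,
      IsUniformAddGroup.rightUniformSpace_eq]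
    infer_instance

theorem rangeSeminorm_apply (φ : E →ₗ[ℂ] V) (s : LinearMap.range φ) :
    rangeSeminorm φ s = ⨅ x : {x : E // φ x = s}, ‖x.1‖ := rfl

theorem rangeSeminorm_le (φ : E →ₗ[ℂ] V) {s : LinearMap.range φ} {x : E} (h : φ x = s) :
    rangeSeminorm φ s ≤ ‖x‖ :=
  ciInf_le ⟨0, by rintro _ ⟨x, rfl⟩; exact norm_nonneg _⟩ (⟨x, h⟩ : {x : E // φ x = s})

theorem le_rangeSeminorm (φ : E →ₗ[ℂ] V) {s : LinearMap.range φ} {c : ℝ}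
    (h : ∀ x, φ x = s → c ≤ ‖x‖) : c ≤ rangeSeminorm φ s := by
  have : Nonempty {x : E // φ x = (s : V)} := let ⟨x, hx⟩ := s.2; ⟨⟨x, hx⟩⟩
  exact le_ciInf fun x => h x.1 x.2

theorem rangeSeminorm_quotKerEquivRange (φ : E →ₗ[ℂ] V) (q : E ⧸ LinearMap.ker φ) :
    rangeSeminorm φ (φ.quotKerEquivRange q) = ‖q‖ := by
  obtain ⟨x, rfl⟩ := Submodule.Quotient.mk_surjective _ q
  refine le_antisymm (le_of_forall_pos_lt_add fun ε hε => ?_) (le_rangeSeminorm φ fun y hy => ?_)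
  · obtain ⟨y, hy, hy'⟩ := Submodule.Quotient.norm_mk_lt
      (Submodule.Quotient.mk x : E ⧸ LinearMap.ker φ) hε
    refine (rangeSeminorm_le φ (x := y) ?_).trans_lt hy'
    rw [← hy]
    simp
  · have : (Submodule.Quotient.mk x : E ⧸ LinearMap.ker φ) = Submodule.Quotient.mk y := by
      apply φ.quotKerEquivRange.injective
      exact Subtype.ext (by simpa using hy.symm)
    rw [this]
    exact Submodule.Quotient.norm_mk_le _ y

/-- The range is isometric to `E ⧸ ker φ`, a Banach space because the kernel is closed. -/
theorem ofRange_isFrechet [CompleteSpace E] (φ : E →ₗ[ℂ] V)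
    (hφ : IsClosed (LinearMap.ker φ : Set E)) : (ofRange φ).IsFrechet := by
  have : IsClosed (LinearMap.ker φ : Set E) := hφ
  rw [isFrechet_iff]
  -- Written as an infimum over one point, so that `IsFrechetTopology.iInf_induced` applies.
  have htop : (ofRange φ).top = ⨅ _ : Unit, (inferInstance :
      TopologicalSpace (E ⧸ LinearMap.ker φ)).induced φ.quotKerEquivRange.symm.toLinearMap := by
    rw [iInf_unique]
    let := (rangeSeminorm φ).toSeminormedAddCommGroup
    have : Isometry (φ.quotKerEquivRange.symm : LinearMap.range φ → E ⧸ LinearMap.ker φ) := by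
      refine AddMonoidHomClass.isometry_of_norm φ.quotKerEquivRange.symm fun s => ?_
      rw [← rangeSeminorm_quotKerEquivRange, LinearEquiv.apply_symm_apply]
      rfl
    exact this.isUniformInducing.isInducing.eq_induced
  rw [htop]
  exact IsFrechetTopology.iInf_induced (fun _ => isFrechetTopology_of_normedSpace _) _
    (fun x y hxy => φ.quotKerEquivRange.symm.injective (hxy ()))
    fun f y _ _ => ⟨φ.quotKerEquivRange (y ()),
      fun _ => φ.quotKerEquivRange.symm_apply_apply (y ())⟩

/-- A norm bound on representatives passes to the infimum. The lift `T` need not be linear, so x ↦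
x* is covered. -/
theorem ofRange_le_comap {E' : Type*} [SeminormedAddCommGroup E'] [NormedSpace ℂ E']
    {σ : ℂ →+* ℂ} {φ : E →ₗ[ℂ] V} {ψ : E' →ₗ[ℂ] W} (L : V →ₛₗ[σ] W) (T : E → E') (C : ℝ)
    (hT : ∀ x, ‖T x‖ ≤ C * ‖x‖) (h : ∀ x, L (φ x) = ψ (T x)) :
    ofRange φ ≤ comap L (ofRange ψ) := by
  have hmem : ∀ v ∈ LinearMap.range φ, L v ∈ LinearMap.range ψ := by
    rintro _ ⟨x, rfl⟩
    exact ⟨T x, (h x).symm⟩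
  refine le_comap_iff.mpr ⟨hmem, ?_⟩
  let g : LinearMap.range φ →+ LinearMap.range ψ :=
    { toFun := fun v => ⟨L v, hmem v v.2⟩
      map_zero' := Subtype.ext (map_zero L)
      map_add' := fun v w => Subtype.ext (map_add L v.1 w.1) }
  let := (rangeSeminorm φ).toSeminormedAddCommGroup
  let := (rangeSeminorm ψ).toSeminormedAddCommGroup
  -- The sign of `C` is not prescribed; a nonnegative constant is needed to pull it through the
  -- infimum.
  refine AddMonoidHomClass.continuous_of_bound g (max C 0) fun s => ?_
  change rangeSeminorm ψ (g s) ≤ max C 0 * rangeSeminorm φ s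
  rw [rangeSeminorm_apply φ, Real.mul_iInf_of_nonneg (le_max_right _ _)]
  have : Nonempty {x : E // φ x = (s : V)} := let ⟨x, hx⟩ := s.2; ⟨⟨x, hx⟩⟩
  refine le_ciInf fun x => ?_
  refine (rangeSeminorm_le ψ (x := T x) ?_).trans ((hT x).trans ?_)
  · rw [← h, x.2]
    rfl
  · exact mul_le_mul_of_nonneg_right (le_max_left _ _) (norm_nonneg _)

end OfRange

/-! ### Hausdorff spaces -/

/-- The field `ℂ` as a topological subspace of itself. -/
def scalars : TopSubspace ℂ := ofRange (LinearMap.id : ℂ →ₗ[ℂ] ℂ)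

theorem scalars_isFrechet : scalars.IsFrechet :=
  ofRange_isFrechet _ (by simp)

/-- A family of linear functionals that separates points makes a space Hausdorff as soon as
all of them are continuous on it. -/
theorem t2Space_of_separating {ι : Type*} {X : TopSubspace V} (e : ι → V →ₗ[ℂ] ℂ)
    (he : ∀ v, (∀ i, e i v = 0) → v = 0) (h : ∀ i, X ≤ comap (e i) scalars) :
    @T2Space X.carrier X.top := by
  choose h₁ c₁ using fun i => le_comap_iff.mp (h i)
  let := X.top; let := scalars.top
  have : T2Space scalars.carrier := scalars_isFrechet.t2Space
  refine ⟨fun x y hxy => ?_⟩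
  obtain ⟨i, hi⟩ : ∃ i, e i x ≠ e i y := by
    by_contra! hcon
    refine hxy (Subtype.ext (sub_eq_zero.mp (he _ fun i => ?_)))
    rw [map_sub, hcon, sub_self]
  exact separated_by_continuous (c₁ i) fun hh => hi (congrArg Subtype.val hh)

end TopSubspace

section Operators

open scoped InnerProductSpace

variable {H : Type*} [NormedAddCommGroup H] [InnerProductSpace ℂ H] [CompleteSpace H]

/-! ### The resolvent of a positive selfadjoint operator -/

omit [CompleteSpace H] in
-- Cauchy–Schwarz applied to ‖f‖² ≤ Re ⟪f, f + a f⟫. It makes 1 + a injective with closed range and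
-- its inverse a contraction.
theorem IsPositiveOperator.norm_le_norm_add {a : H →ₗ.[ℂ] H} (hpos : IsPositiveOperator a)
    (f : a.domain) : ‖(f : H)‖ ≤ ‖(f : H) + a f‖ := by
  rcases eq_or_lt_of_le (norm_nonneg (f : H)) with h0 | h0
  · rw [← h0]; positivity
  refine le_of_mul_le_mul_left ?_ h0
  calc ‖(f : H)‖ * ‖(f : H)‖ = (inner ℂ (f : H) (f : H)).re := by
        rw [← sq]; exact (inner_self_eq_norm_sq (𝕜 := ℂ) (f : H)).symm
    _ ≤ (inner ℂ (f : H) ((f : H) + a f)).re := by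
        rw [inner_add_right, Complex.add_re]; linarith [hpos f]
    _ ≤ ‖(f : H)‖ * ‖(f : H) + a f‖ := re_inner_le_norm (𝕜 := ℂ) _ _

omit [CompleteSpace H] in
theorem IsPositiveOperator.eq_zero_of_add_eq_zero {a : H →ₗ.[ℂ] H} (hpos : IsPositiveOperator a)
    {f : a.domain} (h : (f : H) + a f = 0) : (f : H) = 0 :=
  norm_le_zero_iff.mp ((hpos.norm_le_norm_add f).trans (by rw [h, norm_zero]))

theorem LinearPMap.exists_shiftInv {a : H →ₗ.[ℂ] H} (ha : IsSelfAdjoint a)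
    (hpos : IsPositiveOperator a) :
    ∃ R : H →L[ℂ] H, ∀ v : H, ∃ hv : R v ∈ a.domain, R v + a ⟨R v, hv⟩ = v := by
  let S : a.domain →ₗ[ℂ] H := a.domain.subtype + a.toFun
  have hS (f : a.domain) : S f = f + a f := rfl
  -- A vector w orthogonal to the range of 1 + a lies in D(a*) = D(a) with a w = -w, so it vanishes
  -- by positivity.
  have hdense : (LinearMap.range S)ᗮ = ⊥ := by
    refine (Submodule.eq_bot_iff _).mpr fun w hw => ?_
    have hw' (f : a.domain) : ⟪-w, (f : H)⟫_ℂ = ⟪w, a f⟫_ℂ := by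
      have := Submodule.inner_left_of_mem_orthogonal (LinearMap.mem_range_self S f) hw
      rw [hS, inner_add_right] at this
      rw [inner_neg_left]
      linear_combination -this
    have hmem : w ∈ a.adjoint.domain := a.mem_adjoint_domain_of_exists w ⟨-w, hw'⟩
    have hval : a.adjoint ⟨w, hmem⟩ = -w :=
      LinearPMap.adjoint_apply_eq ha.dense_domain ⟨w, hmem⟩ hw'
    rw [LinearPMap.isSelfAdjoint_def] at ha
    have : ∃ hm : w ∈ a.domain, a ⟨w, hm⟩ = -w := by
      rw [← ha]
      exact ⟨hmem, hval⟩
    obtain ⟨hm, hv⟩ := this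
    exact hpos.eq_zero_of_add_eq_zero (f := ⟨w, hm⟩) (by simp [hv])
  -- If f n + a (f n) converges, the lower bound makes f n Cauchy, and the closed graph of a
  -- identifies the limit.
  have hclosed : _root_.IsClosed (LinearMap.range S : Set H) := by
    refine IsSeqClosed.isClosed fun u v hu huv => ?_
    choose f hf using hu
    have hcau : CauchySeq fun n => (f n : H) := by
      refine Metric.cauchySeq_iff'.mpr fun ε hε => ?_
      obtain ⟨N, hN⟩ := Metric.cauchySeq_iff'.mp huv.cauchySeq ε hε
      refine ⟨N, fun n hn => lt_of_le_of_lt ?_ (hN n hn)⟩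
      have := hpos.norm_le_norm_add (f n - f N)
      rw [← hS, _root_.map_sub, hf, hf] at this
      simpa [dist_eq_norm] using this
    obtain ⟨g, hg⟩ := cauchySeq_tendsto_of_complete hcau
    have hag : Filter.Tendsto (fun n => a (f n)) Filter.atTop (nhds (v - g)) := by
      refine (huv.sub hg).congr fun n => ?_
      rw [← hf, hS]
      abel
    have hgr : (g, v - g) ∈ (a.graph : Set (H × H)) :=
      ha.isClosed.mem_of_tendsto (hg.prodMk_nhds hag)
        (Filter.Eventually.of_forall fun n => a.mem_graph (f n))
    obtain ⟨y, hy, hy'⟩ := (LinearPMap.mem_graph_iff a).mp hgr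
    simp only at hy hy'
    exact ⟨y, by rw [hS, hy, hy']; abel⟩
  have hsurj : Function.Surjective S := by
    have : CompleteSpace (LinearMap.range S) := hclosed.completeSpace_coe
    exact LinearMap.range_eq_top.mp ((Submodule.orthogonal_eq_bot_iff).mp hdense)
  have hinj : Function.Injective S := by
    rw [← LinearMap.ker_eq_bot, LinearMap.ker_eq_bot']
    exact fun f hf => Subtype.ext (hpos.eq_zero_of_add_eq_zero hf)
  let e := LinearEquiv.ofBijective S ⟨hinj, hsurj⟩
  have he (v : H) : S (e.symm v) = v := e.apply_symm_apply v
  refine ⟨(a.domain.subtype.comp e.symm.toLinearMap).mkContinuous 1 fun v => ?_, fun v =>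
    ⟨(e.symm v).2, he v⟩⟩
  rw [one_mul]
  simpa [← hS, he v] using hpos.norm_le_norm_add (e.symm v)

omit [CompleteSpace H] in
-- It computes the resolvents of a p₀ and a p_∞ without first showing these operators to be
-- selfadjoint.
theorem shiftInv_eq {b : H →ₗ.[ℂ] H} {R : H →L[ℂ] H}
    (hR : ∀ v : H, ∃ hv : R v ∈ b.domain, R v + b ⟨R v, hv⟩ = v)
    (hinj : ∀ f : b.domain, (f : H) + b f = 0 → (f : H) = 0) : shiftInv b = R := by
  have hex : ∃ R : H →L[ℂ] H, ∀ v : H, ∃ hv : R v ∈ b.domain, R v + b ⟨R v, hv⟩ = v := ⟨R, hR⟩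
  rw [shiftInv, dif_pos hex]
  ext v
  obtain ⟨h₁, e₁⟩ := hex.choose_spec v
  obtain ⟨h₂, e₂⟩ := hR v
  have := hinj (⟨_, h₁⟩ - ⟨_, h₂⟩) (by
    rw [LinearPMap.map_sub, Submodule.coe_sub, sub_add_sub_comm]
    exact sub_eq_zero.mpr (e₁.trans e₂.symm))
  exact sub_eq_zero.mp this

/-- A bounded selfadjoint injective operator between `0` and `1` is what the resolvent
`(1 + b)⁻¹` of a positive selfadjoint operator `b` is. -/
structure IsResolventLike (R : H →L[ℂ] H) : Prop where
  nonneg : 0 ≤ R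
  le_one : R ≤ 1
  injective : Function.Injective R

theorem shiftInv_spec {a : H →ₗ.[ℂ] H} (ha : IsSelfAdjoint a)
    (hpos : IsPositiveOperator a) (v : H) : ∃ hv : shiftInv a v ∈ a.domain,
    shiftInv a v + a ⟨shiftInv a v, hv⟩ = v := by
  have h := LinearPMap.exists_shiftInv ha hpos
  rw [shiftInv, dif_pos h]
  exact h.choose_spec v

theorem shiftInv_add_apply {a : H →ₗ.[ℂ] H} (ha : IsSelfAdjoint a)
    (hpos : IsPositiveOperator a) (f : a.domain) : shiftInv a (f + a f) = f := by
  obtain ⟨h, e⟩ := shiftInv_spec ha hpos ((f : H) + a f)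
  have := hpos.eq_zero_of_add_eq_zero (f := ⟨_, h⟩ - f) (by
    rw [LinearPMap.map_sub, Submodule.coe_sub, sub_add_sub_comm]
    exact sub_eq_zero.mpr e)
  exact sub_eq_zero.mp this

/-- By the bicommutant theorem it is enough to commute with each y in the commutant: y R v lies in
D(a) and (1 + a) y R v = y v. -/
theorem shiftInv_mem {a : H →ₗ.[ℂ] H} (ha : IsSelfAdjoint a)
    (hpos : IsPositiveOperator a) {M : VonNeumannAlgebra H} (haff : IsAffiliated a M) : shiftInv a ∈ M := by
  rw [← M.commutant_commutant, VonNeumannAlgebra.mem_commutant_iff]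
  intro y hy
  ext v
  obtain ⟨h, e⟩ := shiftInv_spec ha hpos v
  obtain ⟨h', e'⟩ := haff y hy ⟨_, h⟩
  have := shiftInv_add_apply ha hpos ⟨_, h'⟩
  simp only [e', ← map_add, e] at this
  exact this.symm

theorem LinearPMap.inner_apply_comm {a : H →ₗ.[ℂ] H} (ha : IsSelfAdjoint a)
    (f g : a.domain) : ⟪a f, (g : H)⟫_ℂ = ⟪(f : H), a g⟫_ℂ := by
  have h := a.adjoint_isFormalAdjoint ha.dense_domain
  rw [LinearPMap.isSelfAdjoint_def] at ha
  rw [ha] at h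
  exact h f g

theorem shiftInv_isResolventLike {a : H →ₗ.[ℂ] H} (ha : IsSelfAdjoint a)
    (hpos : IsPositiveOperator a) : IsResolventLike (shiftInv a) := by
  set R := shiftInv a with hRdef
  choose hm he using shiftInv_spec ha hpos
  have hsymm : R.toLinearMap.IsSymmetric := fun v w => by
    change ⟪R v, w⟫_ℂ = ⟪v, R w⟫_ℂ
    conv_lhs => rw [← he w]
    conv_rhs => rw [← he v]
    rw [inner_add_left, inner_add_right, ← LinearPMap.inner_apply_comm ha ⟨R v, hm v⟩ ⟨R w, hm w⟩]
  refine ⟨?_, ?_, ?_⟩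
  · rw [ContinuousLinearMap.nonneg_iff_isPositive]
    refine ⟨hsymm, fun v => ?_⟩
    change 0 ≤ (⟪R v, v⟫_ℂ).re
    have h := he v
    set g : a.domain := ⟨R v, hm v⟩
    change 0 ≤ (⟪(g : H), v⟫_ℂ).re
    rw [← h, inner_add_right, Complex.add_re]
    exact add_nonneg (inner_self_nonneg (𝕜 := ℂ)) (hpos g)
  · rw [ContinuousLinearMap.le_def]
    refine ⟨(LinearMap.IsSymmetric.id).sub hsymm, fun v => ?_⟩
    change 0 ≤ (⟪v - R v, v⟫_ℂ).re
    -- With g = R v one has v - R v = a g, so the form equals ⟪g, a g⟫ + ‖a g‖².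
    have h := he v
    change (⟨R v, hm v⟩ : a.domain) + a ⟨R v, hm v⟩ = v at h
    change 0 ≤ (⟪v - (⟨R v, hm v⟩ : a.domain), v⟫_ℂ).re
    generalize (⟨R v, hm v⟩ : a.domain) = g at h ⊢
    rw [← h, add_sub_cancel_left, inner_add_right, Complex.add_re,
      LinearPMap.inner_apply_comm ha]
    exact add_nonneg (hpos g) (inner_self_nonneg (𝕜 := ℂ))
  · refine (injective_iff_map_eq_zero R).mpr fun v hv => ?_
    have := he v
    have h0 : (⟨R v, hm v⟩ : a.domain) = 0 := Subtype.ext hv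
    change R v + a ⟨R v, hm v⟩ = v at this
    rw [h0, hv, LinearPMap.map_zero, add_zero] at this
    exact this.symm

/-! ### Powers -/

theorem VonNeumannAlgebra.cfc_real_mem {M : VonNeumannAlgebra H} {R : H →L[ℂ] H} (hR : R ∈ M) (g : ℝ → ℝ) :
    cfc g R ∈ M := by
  rw [← M.commutant_commutant, VonNeumannAlgebra.mem_commutant_iff]
  intro y hy
  rw [VonNeumannAlgebra.mem_commutant_iff] at hy
  exact (Commute.cfc_real (hy R hR) g).symm

namespace IsResolventLike

variable {R : H →L[ℂ] H}

theorem spectrum_subset (h : IsResolventLike R) {t : ℝ} (ht : t ∈ spectrum ℝ R) :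
    t ∈ Set.Icc (0 : ℝ) 1 := by
  have hsa : IsSelfAdjoint R := .of_nonneg h.nonneg
  refine ⟨spectrum_nonneg_of_nonneg h.nonneg ht, ?_⟩
  have := h.le_one
  rw [← map_one (algebraMap ℝ (H →L[ℂ] H)), le_algebraMap_iff_spectrum_le] at this
  exact this t ht

theorem rpow_eq (h : IsResolventLike R) (α : ℝ) : R ^ α = cfc (fun t : ℝ => t ^ α) R :=
  CFC.rpow_eq_cfc_real h.nonneg

theorem one_sub_rpow_eq (h : IsResolventLike R) {α : ℝ} (hα : 0 ≤ α) :
    (1 - R) ^ α = cfc (fun t : ℝ => (1 - t) ^ α) R := by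
  have hsa : IsSelfAdjoint R := .of_nonneg h.nonneg
  have h1 : 1 - R = cfc (fun t : ℝ => 1 - t) R := by
    rw [cfc_sub .., cfc_const_one .., cfc_id' ..]
  rw [CFC.rpow_eq_cfc_real (sub_nonneg.mpr h.le_one), h1,
    ← cfc_comp' (fun t : ℝ => t ^ α) (fun t => 1 - t) R
      (Real.continuous_rpow_const hα).continuousOn (by fun_prop)]

/-- For an integer n > α, the injective operator Rⁿ factors as R^(n-α) R^α. -/
theorem rpow_injective (h : IsResolventLike R) {α : ℝ} (hα : 0 < α) :
    Function.Injective (R ^ α : H →L[ℂ] H) := by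
  have hsa : IsSelfAdjoint R := .of_nonneg h.nonneg
  have hn : α < (⌊α⌋₊ + 1 : ℕ) := by exact_mod_cast Nat.lt_floor_add_one α
  set n := ⌊α⌋₊ + 1
  have key : cfc (fun t : ℝ => t ^ ((n : ℝ) - α)) R * (R ^ α : H →L[ℂ] H) = R ^ n := by
    rw [h.rpow_eq, ← cfc_pow_id (R := ℝ) R n, ← cfc_mul _ _ R
      (Real.continuous_rpow_const (by linarith)).continuousOn
      (Real.continuous_rpow_const hα.le).continuousOn]
    refine cfc_congr fun t ht => ?_
    have h0 := (h.spectrum_subset ht).1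
    change t ^ ((n : ℝ) - α) * t ^ α = t ^ n
    rw [← Real.rpow_add_of_nonneg h0 (by linarith) hα.le, sub_add_cancel, Real.rpow_natCast]
  have hpow : Function.Injective (R ^ n : H →L[ℂ] H) := by
    rw [show ⇑(R ^ n) = R^[n] from by ext; simp]
    exact h.injective.iterate n
  rw [← key] at hpow
  exact Function.Injective.of_comp hpow

end IsResolventLike

theorem opPow_spec {b : H →ₗ.[ℂ] H} (h : IsResolventLike (shiftInv b)) {α : ℝ} (hα : 0 < α)
    (f : (opPow b α).domain) : ∃ v : H, (shiftInv b ^ α : H →L[ℂ] H) v = f ∧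
      opPow b α f = ((1 - shiftInv b) ^ α : H →L[ℂ] H) v := by
  -- Injectivity of R^α makes the relation defining `opPow` single-valued, hence a graph.
  have hg : ∀ x ∈ LinearMap.range (((shiftInv b) ^ α : H →L[ℂ] H).toLinearMap.prod
      ((1 - shiftInv b) ^ α : H →L[ℂ] H).toLinearMap), x.1 = 0 → x.2 = 0 := by
    rintro _ ⟨v, rfl⟩ hv
    have : v = 0 := h.rpow_injective hα (by simpa using hv)
    simp [this]
  obtain ⟨v, hv⟩ := Submodule.mem_graph_toLinearPMap hg f
  exact ⟨v, congrArg Prod.fst hv, (congrArg Prod.snd hv).symm⟩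

/-- The vectors representing `f` in the domains of two powers of `b` differ by a power of the
resolvent. -/
theorem opPow_spec₂ {b : H →ₗ.[ℂ] H} (h : IsResolventLike (shiftInv b)) {α γ : ℝ} (hα : 0 < α)
    (hγ : 0 < γ) {f : H} (hf : f ∈ (opPow b α).domain) (hf' : f ∈ (opPow b (α + γ)).domain) :
    ∃ v : H, opPow b (α + γ) ⟨f, hf'⟩ = ((1 - shiftInv b) ^ (α + γ) : H →L[ℂ] H) v ∧
      opPow b α ⟨f, hf⟩ =
        ((1 - shiftInv b) ^ α : H →L[ℂ] H) ((shiftInv b ^ γ : H →L[ℂ] H) v) := by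
  obtain ⟨v, hv, e⟩ := opPow_spec h hα ⟨f, hf⟩
  obtain ⟨v', hv', e'⟩ := opPow_spec h (add_pos hα hγ) ⟨f, hf'⟩
  refine ⟨v', e', ?_⟩
  rw [e]
  congr 1
  apply h.rpow_injective hα
  have hmul : (shiftInv b ^ (α + γ) : H →L[ℂ] H) = shiftInv b ^ α * shiftInv b ^ γ := by
    simp only [h.rpow_eq]
    rw [← cfc_mul _ _ _ (Real.continuous_rpow_const hα.le).continuousOn
      (Real.continuous_rpow_const hγ.le).continuousOn]
    exact cfc_congr fun t ht => Real.rpow_add_of_nonneg (h.spectrum_subset ht).1 hα.le hγ.le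
  rw [hmul] at hv'
  exact hv.trans hv'.symm

/-- The multiplier is b^γ = ((1 - R)/R)^γ, which is bounded since R ≥ 1/2. -/
theorem opPow_add_eq_of_half_le {b : H →ₗ.[ℂ] H} {M : VonNeumannAlgebra H}
    (h : IsResolventLike (shiftInv b)) (hM : shiftInv b ∈ M)
    (hspec : ∀ t ∈ spectrum ℝ (shiftInv b), 1 / 2 ≤ t) {α γ : ℝ} (hα : 0 < α) (hγ : 0 < γ) :
    ∃ y ∈ M, ∀ (f : H) (hf : f ∈ (opPow b α).domain) (hf' : f ∈ (opPow b (α + γ)).domain),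
      opPow b (α + γ) ⟨f, hf'⟩ = y (opPow b α ⟨f, hf⟩) := by
  have hsa : IsSelfAdjoint (shiftInv b) := .of_nonneg h.nonneg
  -- The truncation at 1/2 removes the singularity at 0 and changes nothing on the spectrum.
  have hc : ContinuousOn (fun t : ℝ => (1 - t) ^ γ * (max t (1 / 2)) ^ (-γ))
      (spectrum ℝ (shiftInv b)) := by
    refine Continuous.continuousOn (.mul (.rpow_const (by fun_prop) fun _ => .inr hγ.le)
      (.rpow_const (by fun_prop) fun t => .inl ?_))
    have := le_max_right t (1 / 2)
    linarith
  have hcα : ContinuousOn (fun t : ℝ => (1 - t) ^ α) (spectrum ℝ (shiftInv b)) :=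
    Continuous.continuousOn (.rpow_const (by fun_prop) fun _ => .inr hα.le)
  have hc' : ContinuousOn (fun t : ℝ => (1 - t) ^ γ * (max t (1 / 2)) ^ (-γ) * (1 - t) ^ α)
      (spectrum ℝ (shiftInv b)) := hc.mul hcα
  refine ⟨_, VonNeumannAlgebra.cfc_real_mem hM fun t => (1 - t) ^ γ * (max t (1 / 2)) ^ (-γ), fun f hf hf' => ?_⟩
  obtain ⟨v, hv, hv'⟩ := opPow_spec₂ h hα hγ hf hf'
  rw [hv, hv']
  simp only [← mul_apply_eq_comp]
  congr 1
  rw [h.one_sub_rpow_eq (add_pos hα hγ).le, h.one_sub_rpow_eq hα.le, h.rpow_eq, ← mul_assoc,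
    ← cfc_mul _ _ _ hc hcα, ← cfc_mul _ _ _ hc' (Real.continuous_rpow_const hγ.le).continuousOn]
  refine cfc_congr fun t ht => ?_
  have h1 := h.spectrum_subset ht
  have h2 := hspec t ht
  have h3 : 0 < t := by linarith
  simp only [max_eq_left h2]
  rw [Real.rpow_add_of_nonneg (by linarith [h1.2]) hα.le hγ.le, Real.rpow_neg h3.le]
  have := (Real.rpow_pos_of_pos h3 γ).ne'
  field_simp

/-- The multiplier is (R/(1 - R))^γ, bounded where R ≤ 1/2. At the point 1, where b is zero, both
powers of 1 - R vanish, so the value of the multiplier there is irrelevant. -/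
theorem opPow_eq_of_spectrum_le_half {b : H →ₗ.[ℂ] H} {M : VonNeumannAlgebra H}
    (h : IsResolventLike (shiftInv b)) (hM : shiftInv b ∈ M)
    (hspec : ∀ t ∈ spectrum ℝ (shiftInv b), t ≤ 1 / 2 ∨ t = 1) {α γ : ℝ} (hα : 0 < α)
    (hγ : 0 < γ) :
    ∃ y ∈ M, ∀ (f : H) (hf : f ∈ (opPow b α).domain) (hf' : f ∈ (opPow b (α + γ)).domain),
      opPow b α ⟨f, hf⟩ = y (opPow b (α + γ) ⟨f, hf'⟩) := by
  have hsa : IsSelfAdjoint (shiftInv b) := .of_nonneg h.nonneg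
  have hc : ContinuousOn (fun t : ℝ => t ^ γ * (max (1 - t) (1 / 2)) ^ (-γ))
      (spectrum ℝ (shiftInv b)) := by
    refine Continuous.continuousOn (.mul (Real.continuous_rpow_const hγ.le)
      (.rpow_const (by fun_prop) fun t => .inl ?_))
    have := le_max_right (1 - t) (1 / 2)
    linarith
  refine ⟨_, VonNeumannAlgebra.cfc_real_mem hM fun t => t ^ γ * (max (1 - t) (1 / 2)) ^ (-γ), fun f hf hf' => ?_⟩
  obtain ⟨v, hv, hv'⟩ := opPow_spec₂ h hα hγ hf hf'
  rw [hv, hv']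
  simp only [← mul_apply_eq_comp]
  congr 1
  rw [h.one_sub_rpow_eq (add_pos hα hγ).le, h.one_sub_rpow_eq hα.le, h.rpow_eq,
    ← cfc_mul _ _ _ hc
      (Continuous.continuousOn (.rpow_const (by fun_prop) fun _ => .inr (add_pos hα hγ).le)),
    ← cfc_mul _ _ _ (Continuous.continuousOn (.rpow_const (by fun_prop) fun _ => .inr hα.le))
      (Real.continuous_rpow_const hγ.le).continuousOn]
  refine cfc_congr fun t ht => ?_
  rcases hspec t ht with h2 | rfl
  · have h3 : 0 < 1 - t := by linarith
    simp only [max_eq_left (by linarith : 1 / 2 ≤ 1 - t)]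
    rw [Real.rpow_add h3, Real.rpow_neg h3.le]
    have := (Real.rpow_pos_of_pos h3 γ).ne'
    field_simp
  · simp [Real.zero_rpow hα.ne', Real.zero_rpow (add_pos hα hγ).ne']

end Operators

section Operators

variable {H : Type*} [NormedAddCommGroup H] [InnerProductSpace ℂ H] [CompleteSpace H]

/-! ### The parts of `a` below and above `1` -/

/-- The operator a q acts as a on the range of q and as zero on its kernel, where the resolvent is
the identity. -/
theorem shiftInv_compBounded {a : H →ₗ.[ℂ] H} (ha : IsSelfAdjoint a)
    (hpos : IsPositiveOperator a) {q : H →L[ℂ] H} (hq : q * q = q)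
    (hqR : q * shiftInv a = shiftInv a * q) :
    shiftInv (compBounded a q) = shiftInv a * q + (1 - q) := by
  have hq' (v : H) : q (q v) = q v := DFunLike.congr_fun hq v
  have hqR' (v : H) : q (shiftInv a v) = shiftInv a (q v) := DFunLike.congr_fun hqR v
  have happ (v : H) (hv : v ∈ (compBounded a q).domain) :
      compBounded a q ⟨v, hv⟩ = a ⟨q v, hv⟩ := rfl
  refine shiftInv_eq (fun v => ?_) fun f hf => ?_
  · have hqv : q ((shiftInv a * q + (1 - q)) v) = shiftInv a (q v) := by
      simp [hqR', hq']
    obtain ⟨h, e⟩ := shiftInv_spec ha hpos (q v)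
    have hmem : (shiftInv a * q + (1 - q)) v ∈ (compBounded a q).domain := by
      change q _ ∈ a.domain
      rwa [hqv]
    refine ⟨hmem, ?_⟩
    rw [happ]
    simp only [hqv]
    rw [eq_sub_of_add_eq' e]
    simp only [add_apply, sub_apply, mul_apply_eq_comp, one_apply_eq_self]
    abel
  · obtain ⟨w, hw⟩ := f
    rw [happ] at hf
    simp only at hf ⊢
    -- From w + a q w = 0 follows R (q w - w) = q w; applying q, which commutes with R, turns the
    -- left side into 0.
    have hz : q w = 0 := by
      have h₁ := shiftInv_add_apply ha hpos ⟨q w, hw⟩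
      simp only at h₁
      rw [eq_neg_of_add_eq_zero_right hf] at h₁
      have h₂ := congrArg q h₁
      rw [hqR', hq'] at h₂
      rw [← h₂]
      simp [hq']
    have h0 : (⟨q w, hw⟩ : a.domain) = 0 := Subtype.ext hz
    rwa [h0, LinearPMap.map_zero, add_zero] at hf

theorem IsResolventLike.mul_add_one_sub {R q : H →L[ℂ] H} (h : IsResolventLike R)
    (hq : IsStarProjection q) (hqR : q * R = R * q) : IsResolventLike (R * q + (1 - q)) := by
  have hqq : q * q = q := hq.isIdempotentElem
  have h1 : R * q = star q * R * q := by
    rw [hq.isSelfAdjoint.star_eq, hqR, mul_assoc, hqq]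
  have h2 : q - R * q = star q * (1 - R) * q := by
    rw [hq.isSelfAdjoint.star_eq, mul_sub, sub_mul, mul_one, hqq, hqR, mul_assoc, hqq]
  refine ⟨?_, ?_, ?_⟩
  · refine add_nonneg ?_ hq.one_sub.nonneg
    rw [h1]
    exact star_left_conjugate_nonneg h.nonneg q
  · rw [← sub_nonneg, show 1 - (R * q + (1 - q)) = q - R * q by abel, h2]
    exact star_left_conjugate_nonneg (sub_nonneg.mpr h.le_one) q
  · refine (injective_iff_map_eq_zero _).mpr fun v hv => ?_
    have hqv : q v = 0 := by
      refine (injective_iff_map_eq_zero R).mp h.injective _ ?_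
      have h3 : q * (R * q + (1 - q)) = R * q := by
        rw [mul_add, mul_sub, ← mul_assoc, hqR, mul_assoc, hqq, mul_one, sub_self, add_zero]
      have := DFunLike.congr_fun h3 v
      simp only [mul_apply_eq_comp, hv, map_zero] at this
      exact this.symm
    simpa [hqv] using hv

/-- The projection onto the kernel of the positive part of `1/2 - R`. -/
theorem spectralProj_one (a : H →ₗ.[ℂ] H) : spectralProj a 1 =
    (cfc (fun t : ℝ => max (1 / 2 - t) 0) (shiftInv a)).ker.starProjection := by
  norm_num [spectralProj]

section Projection

variable {R : H →L[ℂ] H}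

theorem apply_mem_ker_cfc {y : H →L[ℂ] H} (hy : Commute R y) (g : ℝ → ℝ) {v : H}
    (hv : v ∈ (cfc g R).ker) : y v ∈ (cfc g R).ker := by
  have hc : cfc g R * y = y * cfc g R := (Commute.cfc_real hy g).eq
  have h0 : cfc g R v = 0 := hv
  change cfc g R (y v) = 0
  rw [← mul_apply_eq_comp, hc, mul_apply_eq_comp, h0, map_zero]

theorem commute_starProjection_ker_cfc (hR : IsSelfAdjoint R) (g : ℝ → ℝ) :
    (cfc g R).ker.starProjection * R = R * (cfc g R).ker.starProjection := by
  set p := (cfc g R).ker.starProjection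
  -- The kernel is R-invariant, so p R p = R p; the adjoint of this identity gives p R p = p R.
  have h1 : p * R * p = R * p := by
    ext v
    exact Submodule.starProjection_eq_self_iff.mpr
      (apply_mem_ker_cfc (Commute.refl R) g (Submodule.starProjection_apply_mem _ v))
  have hp : star p = p := isStarProjection_starProjection.isSelfAdjoint
  have h2 := congrArg star h1
  simp only [star_mul, hp, hR.star_eq] at h2
  rw [← h2, ← mul_assoc, h1]

theorem starProjection_ker_cfc_mem {M : VonNeumannAlgebra H} (hM : R ∈ M) (g : ℝ → ℝ) :
    (cfc g R).ker.starProjection ∈ M := by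
  rw [VonNeumannAlgebra.IsStarProjection.mem_iff isStarProjection_starProjection]
  intro y hy
  rw [VonNeumannAlgebra.mem_commutant_iff] at hy
  rw [Submodule.range_starProjection]
  exact fun v hv => apply_mem_ker_cfc (hy R hM) g hv

/-- `R` splits along the kernel of the positive part of `1/2 - R`. -/
theorem sub_half_mul_starProjection (hR : IsSelfAdjoint R) :
    let p := (cfc (fun t : ℝ => max (1 / 2 - t) 0) R).ker.starProjection
    (R - algebraMap ℝ _ (1 / 2)) * p = cfc (fun t : ℝ => max (t - 1 / 2) 0) R * p ∧
    (algebraMap ℝ _ (1 / 2) - R) * (1 - p) =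
      cfc (fun t : ℝ => max (1 / 2 - t) 0) R * (1 - p) := by
  intro p
  set T := cfc (fun t : ℝ => max (1 / 2 - t) 0) R with hT
  set S := cfc (fun t : ℝ => max (t - 1 / 2) 0) R with hS
  have hdiff : R - algebraMap ℝ _ (1 / 2) = S - T := by
    rw [hT, hS, ← cfc_sub _ _ R (by fun_prop) (by fun_prop)]
    conv_lhs => rw [← cfc_id' ℝ R, ← cfc_const (1 / 2 : ℝ) R, ← cfc_sub _ _ R]
    refine cfc_congr fun t _ => ?_
    rcases le_total t (1 / 2) with h | h
    · simp only [max_eq_right (sub_nonpos.mpr h), max_eq_left (sub_nonneg.mpr h)]; ring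
    · simp only [max_eq_right (sub_nonpos.mpr h), max_eq_left (sub_nonneg.mpr h)]; ring
  have hTp : T * p = 0 := by
    ext v
    exact Submodule.starProjection_apply_mem T.ker v
  have hTS : T * S = 0 := by
    rw [hT, hS, ← cfc_mul _ _ R (by fun_prop) (by fun_prop), ← cfc_const_zero ℝ R]
    refine cfc_congr fun t _ => ?_
    rcases le_total t (1 / 2) with h | h
    · simp only [max_eq_right (sub_nonpos.mpr h), mul_zero]
    · simp only [max_eq_right (sub_nonpos.mpr h), zero_mul]
  -- T S = 0 puts the range of S inside ker T, the range of p.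
  have hpS : p * S = S := by
    ext v
    exact Submodule.starProjection_eq_self_iff.mpr (DFunLike.congr_fun hTS v)
  have hSp : S * p = S := by
    have hp : star p = p := isStarProjection_starProjection.isSelfAdjoint
    have hS' : star S = S := (cfc_predicate _ R : IsSelfAdjoint S).star_eq
    simpa only [star_mul, hp, hS'] using congrArg star hpS
  refine ⟨by rw [hdiff, sub_mul, hTp, sub_zero], ?_⟩
  rw [← neg_sub R, hdiff, neg_sub, sub_mul, mul_sub S, hSp, mul_one, sub_self, sub_zero]

theorem half_le_of_mem_spectrum (h : IsResolventLike R) {t : ℝ}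
    (ht : t ∈ spectrum ℝ (R * (cfc (fun t : ℝ => max (1 / 2 - t) 0) R).ker.starProjection +
      (1 - (cfc (fun t : ℝ => max (1 / 2 - t) 0) R).ker.starProjection))) : 1 / 2 ≤ t := by
  have hR : IsSelfAdjoint R := .of_nonneg h.nonneg
  have h1 := (sub_half_mul_starProjection hR).1
  have hcomm := commute_starProjection_ker_cfc hR fun t : ℝ => max (1 / 2 - t) 0
  have hcomm' : ∀ g : ℝ → ℝ, cfc g R *
      (cfc (fun t : ℝ => max (1 / 2 - t) 0) R).ker.starProjection =
      (cfc (fun t : ℝ => max (1 / 2 - t) 0) R).ker.starProjection * cfc g R := fun g =>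
    (Commute.cfc_real hcomm.symm g).eq
  have hp : IsStarProjection (cfc (fun t : ℝ => max (1 / 2 - t) 0) R).ker.starProjection :=
    isStarProjection_starProjection
  set p := (cfc (fun t : ℝ => max (1 / 2 - t) 0) R).ker.starProjection
  have hR' := h.mul_add_one_sub hp hcomm
  have hsa : IsSelfAdjoint (R * p + (1 - p)) := .of_nonneg hR'.nonneg
  have key : algebraMap ℝ (H →L[ℂ] H) (1 / 2) ≤ R * p + (1 - p) := by
    have hpp : p * p = p := hp.isIdempotentElem
    rw [← sub_nonneg]
    -- On the range of p the difference is the positive part of R - 1/2; on the complement it is 1 -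
    -- 1/2.
    have : R * p + (1 - p) - algebraMap ℝ (H →L[ℂ] H) (1 / 2) =
        star p * cfc (fun t : ℝ => max (t - 1 / 2) 0) R * p +
          (1 / 2 : ℝ) • (1 - p) := by
      rw [hp.isSelfAdjoint.star_eq, ← hcomm', mul_assoc, hpp, ← h1, Algebra.algebraMap_eq_smul_one,
        sub_mul, smul_mul_assoc, one_mul]
      module
    rw [this]
    refine add_nonneg (star_left_conjugate_nonneg (cfc_nonneg fun t _ => le_max_right _ _) p)
      (smul_nonneg (by norm_num) hp.one_sub.nonneg)
  exact (algebraMap_le_iff_le_spectrum (R := ℝ) (a := R * p + (1 - p))).mp key t ht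

/-- With Q the operator in question, (1 - Q)(1/2 - Q) is the compression by q of the positive
operator (1 - R)(1/2 - R)₊. Hence (1 - t)(1/2 - t) ≥ 0 on the spectrum of Q, where also t ≤ 1. -/
theorem le_half_or_eq_one_of_mem_spectrum (h : IsResolventLike R) {t : ℝ}
    (ht : t ∈ spectrum ℝ (R * (1 - (cfc (fun t : ℝ => max (1 / 2 - t) 0) R).ker.starProjection) +
      (1 - (1 - (cfc (fun t : ℝ => max (1 / 2 - t) 0) R).ker.starProjection)))) :
    t ≤ 1 / 2 ∨ t = 1 := by
  have hR : IsSelfAdjoint R := .of_nonneg h.nonneg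
  have h1 := (sub_half_mul_starProjection hR).2
  have hcomm := commute_starProjection_ker_cfc hR fun t : ℝ => max (1 / 2 - t) 0
  have hp : IsStarProjection (1 - (cfc (fun t : ℝ => max (1 / 2 - t) 0) R).ker.starProjection) :=
    isStarProjection_starProjection.one_sub
  have hcomm : (1 - (cfc (fun t : ℝ => max (1 / 2 - t) 0) R).ker.starProjection) * R =
      R * (1 - (cfc (fun t : ℝ => max (1 / 2 - t) 0) R).ker.starProjection) := by
    rw [sub_mul, mul_sub, hcomm, one_mul, mul_one]
  have hcomm' : ∀ g : ℝ → ℝ, cfc g R *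
      (1 - (cfc (fun t : ℝ => max (1 / 2 - t) 0) R).ker.starProjection) =
      (1 - (cfc (fun t : ℝ => max (1 / 2 - t) 0) R).ker.starProjection) * cfc g R := fun g =>
    (Commute.cfc_real hcomm.symm g).eq
  set q := 1 - (cfc (fun t : ℝ => max (1 / 2 - t) 0) R).ker.starProjection
  clear_value q
  have hR' := h.mul_add_one_sub hp hcomm
  set Q := R * q + (1 - q) with hQ
  have hsa : IsSelfAdjoint Q := .of_nonneg hR'.nonneg
  have hqq : q * q = q := hp.isIdempotentElem
  have hcfc : cfc (fun t : ℝ => (1 - t) * (1 / 2 - t)) Q =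
      (1 - Q) * (algebraMap ℝ _ (1 / 2) - Q) := by
    rw [cfc_mul _ _ Q, cfc_sub _ _ Q, cfc_sub _ _ Q, cfc_const_one .., cfc_id' .., cfc_const ..]
  have hprod : cfc (fun t : ℝ => (1 - t) * max (1 / 2 - t) 0) R =
      (1 - R) * cfc (fun t : ℝ => max (1 / 2 - t) 0) R := by
    rw [cfc_mul _ _ R, cfc_sub _ _ R, cfc_const_one .., cfc_id' ..]
  have hpos : 0 ≤ cfc (fun t : ℝ => (1 - t) * max (1 / 2 - t) 0) R :=
    cfc_nonneg fun t ht => mul_nonneg (sub_nonneg.mpr (h.spectrum_subset ht).2) (le_max_right _ _)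
  have key : cfc (fun t : ℝ => (1 - t) * (1 / 2 - t)) Q =
      star q * cfc (fun t : ℝ => (1 - t) * max (1 / 2 - t) 0) R * q := by
    rw [hp.isSelfAdjoint.star_eq, ← hcomm', mul_assoc, hqq, hprod, mul_assoc, ← h1, hcfc]
    have e1 : 1 - Q = (1 - R) * q := by rw [hQ, sub_mul, one_mul]; abel
    have e2 : q * (algebraMap ℝ _ (1 / 2) - Q) = (algebraMap ℝ _ (1 / 2) - R) * q := by
      have hq1 : q * (1 - q) = 0 := by rw [mul_sub, mul_one, hqq, sub_self]
      rw [hQ, mul_sub, mul_add, hq1, add_zero, ← mul_assoc, hcomm, mul_assoc, hqq, sub_mul, Algebra.commutes]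
    rw [e1, mul_assoc, e2]
  have h0 : 0 ≤ cfc (fun t : ℝ => (1 - t) * (1 / 2 - t)) Q := by
    rw [key]
    exact star_left_conjugate_nonneg hpos q
  have h2 := (cfc_nonneg_iff _ Q).mp h0 t ht
  have h3 := (hR'.spectrum_subset ht).2
  rcases eq_or_lt_of_le h3 with h4 | h4
  · exact .inr h4
  · exact .inl (by nlinarith)

end Projection

/-- The resolvents of the two parts of `a` lie in `M`, and their spectra are in `[1/2, 1]` and in
`[0, 1/2] ∪ {1}`, respectively. -/
theorem shiftInv_part {a : H →ₗ.[ℂ] H} {M : VonNeumannAlgebra H} (ha : IsSelfAdjoint a)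
    (hpos : IsPositiveOperator a) (haff : IsAffiliated a M) :
    (∀ i, IsResolventLike (shiftInv (part a i)) ∧ shiftInv (part a i) ∈ M) ∧
    (∀ t ∈ spectrum ℝ (shiftInv (part a 0)), 1 / 2 ≤ t) ∧
    (∀ t ∈ spectrum ℝ (shiftInv (part a 1)), t ≤ 1 / 2 ∨ t = 1) := by
  have h := shiftInv_isResolventLike ha hpos
  have hM := shiftInv_mem ha hpos haff
  have hR : IsSelfAdjoint (shiftInv a) := .of_nonneg h.nonneg
  have hp : IsStarProjection (spectralProj a 1) := isStarProjection_starProjection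
  have hpM : spectralProj a 1 ∈ M := starProjection_ker_cfc_mem hM _
  have hcomm : spectralProj a 1 * shiftInv a = shiftInv a * spectralProj a 1 :=
    commute_starProjection_ker_cfc hR _
  have hcomm' : (1 - spectralProj a 1) * shiftInv a = shiftInv a * (1 - spectralProj a 1) := by
    rw [sub_mul, mul_sub, hcomm, one_mul, mul_one]
  have e0 : shiftInv (part a 0) = _ := shiftInv_compBounded ha hpos hp.isIdempotentElem hcomm
  have e1 : shiftInv (part a 1) = _ :=
    shiftInv_compBounded ha hpos hp.one_sub.isIdempotentElem hcomm'
  refine ⟨Fin.forall_fin_two.mpr ⟨?_, ?_⟩, ?_, ?_⟩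
  · rw [e0]
    exact ⟨h.mul_add_one_sub hp hcomm, add_mem (mul_mem hM hpM) (sub_mem (one_mem M) hpM)⟩
  · rw [e1]
    have := sub_mem (one_mem M) hpM
    exact ⟨h.mul_add_one_sub hp.one_sub hcomm',
      add_mem (mul_mem hM this) (sub_mem (one_mem M) this)⟩
  · rw [e0, spectralProj_one]
    exact fun t => half_le_of_mem_spectrum h
  · rw [e1, spectralProj_one]
    exact fun t => le_half_or_eq_one_of_mem_spectrum h

/-- Positive powers of `a₀` are bounded multiples, in `M`, of smaller ones. -/
theorem powOn_zero_of_le {a : H →ₗ.[ℂ] H} {M : VonNeumannAlgebra H} (ha : IsSelfAdjoint a)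
    (hpos : IsPositiveOperator a) (haff : IsAffiliated a M) {α β : Set.Ioi (0 : ℝ)} (h : α ≤ β) :
    ∃ y ∈ M, ∀ f, powOn a 0 β f = y (powOn a 0 α f) := by
  rcases eq_or_lt_of_le h with rfl | h
  · exact ⟨1, one_mem M, fun f => rfl⟩
  obtain ⟨h₁, h₂, -⟩ := shiftInv_part ha hpos haff
  obtain ⟨α, hα⟩ := α
  obtain ⟨β, hβ⟩ := β
  obtain ⟨γ, hγ, rfl⟩ : ∃ γ, 0 < γ ∧ β = α + γ := ⟨β - α, sub_pos.mpr h, by ring⟩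
  obtain ⟨y, hy, e⟩ := opPow_add_eq_of_half_le (h₁ 0).1 (h₁ 0).2 h₂ hα hγ
  exact ⟨y, hy, fun f => e f _ _⟩

/-- Positive powers of `a_∞` are bounded multiples, in `M`, of larger ones. -/
theorem powOn_one_of_le {a : H →ₗ.[ℂ] H} {M : VonNeumannAlgebra H} (ha : IsSelfAdjoint a)
    (hpos : IsPositiveOperator a) (haff : IsAffiliated a M) {α β : Set.Ioi (0 : ℝ)} (h : α ≤ β) :
    ∃ y ∈ M, ∀ f, powOn a 1 α f = y (powOn a 1 β f) := by
  rcases eq_or_lt_of_le h with rfl | h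
  · exact ⟨1, one_mem M, fun f => rfl⟩
  obtain ⟨h₁, -, h₂⟩ := shiftInv_part ha hpos haff
  obtain ⟨α, hα⟩ := α
  obtain ⟨β, hβ⟩ := β
  obtain ⟨γ, hγ, rfl⟩ : ∃ γ, 0 < γ ∧ β = α + γ := ⟨β - α, sub_pos.mpr h, by ring⟩
  obtain ⟨y, hy, e⟩ := opPow_eq_of_spectrum_le_half (h₁ 1).1 (h₁ 1).2 h₂ hα hγ
  exact ⟨y, hy, fun f => e f _ _⟩

end Operators

/-! ### Replacing half-lines of exponents by sequences -/

namespace TopSubspace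

variable {V : Type*} [AddCommGroup V] [Module ℂ V] {c : ℝ}

/-- The point `c + n + 1` of the half-line `(c, ∞)`. -/
def natShift (c : ℝ) (n : ℕ) : Set.Ioi c :=
  ⟨c + (n + 1 : ℕ), lt_add_of_pos_right c (Nat.cast_pos.mpr n.succ_pos)⟩

theorem natShift_mono (c : ℝ) : Monotone (natShift c) := fun _ _ h =>
  add_le_add_right (Nat.cast_le.mpr (Nat.succ_le_succ h)) c

theorem exists_le_natShift (t : Set.Ioi c) : ∃ n, t ≤ natShift c n := by
  obtain ⟨n, hn⟩ := exists_nat_ge ((t : ℝ) - c)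
  refine ⟨n, ?_⟩
  change (t : ℝ) ≤ c + (n + 1 : ℕ)
  push_cast
  linarith

theorem projLimit_Ioi_isFrechet {F : Set.Ioi c → TopSubspace V} (hF : Antitone F)
    (h : ∀ t, (F t).IsFrechet) : (projLimit F).IsFrechet := by
  rw [projLimit_eq_of_coinitial (G := fun n => F (natShift c n))
    (fun t => let ⟨n, hn⟩ := exists_le_natShift t; ⟨n, hF hn⟩) fun n => ⟨natShift c n, le_rfl⟩]
  exact IsFrechet.projLimit (fun n => h _) (hF.comp_monotone (natShift_mono c))

theorem indLimit_Ioi {F : Set.Ioi c → TopSubspace V} (hF : Monotone F) :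
    indLimit F = indLimit fun n => F (natShift c n) :=
  indLimit_eq_of_cofinal
    (fun t => let ⟨n, hn⟩ := exists_le_natShift t; ⟨n, hF hn⟩) fun n => ⟨natShift c n, le_rfl⟩

/-- An inductive limit of Fréchet spaces may fail to be Hausdorff, so separation enters as a
hypothesis. -/
theorem isLF_block_indLimit {m n : Type*} [Finite m] [Finite n]
    {F : m → n → ℕ → TopSubspace V} (hF : ∀ i j, Monotone (F i j))
    (h : ∀ i j k, (F i j k).IsFrechet)
    (hT2 : @T2Space _ (block fun i j => indLimit (F i j)).top) :
    (block fun i j => indLimit (F i j)).IsLF :=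
  ⟨hT2, fun k => block fun i j => F i j k, fun k => .block fun i j => h i j k,
    fun k => block_mono fun i j => hF i j k.le_succ, block_indLimit F⟩

end TopSubspace

/-! ### The spaces of sesquilinear forms and their limits -/

section Operators

open TopSubspace
open scoped InnerProductSpace

variable {H : Type*} [NormedAddCommGroup H] [InnerProductSpace ℂ H] [CompleteSpace H]

theorem formMap_apply (M : VonNeumannAlgebra H) (a : H →ₗ.[ℂ] H) (i j : Fin 2)
    (α β : Set.Ioi (0 : ℝ)) (x : M.toStarSubalgebra.toSubalgebra.toSubmodule)
    (f g : commonDomain a) :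
    formMap M a i j α β x f g = ⟪powOn a i α g, x.1 (powOn a j β f)⟫_ℂ := rfl

/-- Evaluation of sesquilinear forms at a pair of vectors. -/
def SesqForm.eval {a : H →ₗ.[ℂ] H} (f g : commonDomain a) : SesqForm a →ₗ[ℂ] ℂ where
  toFun s := s f g
  map_add' _ _ := rfl
  map_smul' _ _ := rfl

/-- The adjoint form `(f, g) ↦ conj (s g f)`. -/
def SesqForm.adjoint (a : H →ₗ.[ℂ] H) : SesqForm a →ₗ⋆[ℂ] SesqForm a where
  toFun s := LinearMap.mk₂'ₛₗ (RingHom.id ℂ) (starRingEnd ℂ) (fun f g => starRingEnd ℂ (s g f))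
    (fun f f' g => by simp) (fun c f g => by simp) (fun f g g' => by simp)
    (fun c f g => by simp)
  map_add' s t := by ext f g; simp
  map_smul' c s := by ext f g; simp

theorem SesqForm.adjoint_apply {a : H →ₗ.[ℂ] H} (s : SesqForm a) (f g : commonDomain a) :
    SesqForm.adjoint a s f g = starRingEnd ℂ (s g f) := rfl

theorem SesqForm.adjoint_adjoint {a : H →ₗ.[ℂ] H} (s : SesqForm a) :
    SesqForm.adjoint a (SesqForm.adjoint a s) = s := by
  ext f g
  simp [SesqForm.adjoint_apply]

/-- A von Neumann algebra is its own bicommutant, and centralizers are norm closed. -/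
instance (M : VonNeumannAlgebra H) :
    CompleteSpace M.toStarSubalgebra.toSubalgebra.toSubmodule := by
  have : IsClosed (M : Set (H →L[ℂ] H)) := by
    rw [← M.centralizer_centralizer]
    exact Set.isClosed_centralizer _
  exact this.completeSpace_coe

/-- The kernel of x ↦ form is an intersection of zero sets of norm-continuous functionals. -/
theorem formSpace_isFrechet (M : VonNeumannAlgebra H) (a : H →ₗ.[ℂ] H) (i j : Fin 2)
    (α β : Set.Ioi (0 : ℝ)) : (formSpace M a i j α β).IsFrechet := by
  refine ofRange_isFrechet _ ?_
  have : (LinearMap.ker (formMap M a i j α β) :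
      Set M.toStarSubalgebra.toSubalgebra.toSubmodule) =
      ⋂ f, ⋂ g, {x | ⟪powOn a i α g, x.1 (powOn a j β f)⟫_ℂ = 0} := by
    ext x
    simp only [SetLike.mem_coe, LinearMap.mem_ker, Set.mem_iInter, Set.mem_ofPred_eq,
      ← formMap_apply]
    exact ⟨fun h f g => by rw [h]; rfl, fun h => by ext f g; exact h f g⟩
  rw [this]
  refine isClosed_iInter fun f => isClosed_iInter fun g => ?_
  exact isClosed_eq (by fun_prop) continuous_const

/-- If the old powers are z and y times the new ones, ⟨x z b f, y c g⟩ = ⟨y* x z b f, c g⟩, so y* x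
z represents the same form. -/
theorem formSpace_le {M : VonNeumannAlgebra H} {a : H →ₗ.[ℂ] H} {i j : Fin 2}
    {α β α' β' : Set.Ioi (0 : ℝ)} (h : ∃ y ∈ M, ∀ f, powOn a i α f = y (powOn a i α' f))
    (h' : ∃ y ∈ M, ∀ f, powOn a j β f = y (powOn a j β' f)) :
    formSpace M a i j α β ≤ formSpace M a i j α' β' := by
  obtain ⟨y, hy, e⟩ := h
  obtain ⟨z, hz, e'⟩ := h'
  rw [← comap_id (formSpace M a i j α' β')]
  have hmem (x : M.toStarSubalgebra.toSubalgebra.toSubmodule) : star y * x.1 * z ∈ M := by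
    have hx : x.1 ∈ M := x.2
    exact mul_mem (mul_mem (star_mem hy) hx) hz
  refine ofRange_le_comap LinearMap.id (fun x => ⟨star y * x.1 * z, hmem x⟩) (‖y‖ * ‖z‖)
    (fun x => ?_) fun x => ?_
  · change ‖star y * x.1 * z‖ ≤ ‖y‖ * ‖z‖ * ‖x.1‖
    calc ‖star y * x.1 * z‖ ≤ ‖star y‖ * ‖x.1‖ * ‖z‖ := by
          refine (norm_mul_le _ _).trans ?_
          gcongr
          exact norm_mul_le _ _
      _ = ‖y‖ * ‖z‖ * ‖x.1‖ := by rw [norm_star]; ring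
  · ext f g
    rw [LinearMap.id_apply, formMap_apply, formMap_apply, e, e',
      ← ContinuousLinearMap.adjoint_inner_right]
    rfl

theorem formSpace_le_comap_adjoint (M : VonNeumannAlgebra H) (a : H →ₗ.[ℂ] H) (i j : Fin 2)
    (α β : Set.Ioi (0 : ℝ)) :
    formSpace M a i j α β ≤ comap (SesqForm.adjoint a) (formSpace M a j i β α) := by
  have hmem (x : M.toStarSubalgebra.toSubalgebra.toSubmodule) : star x.1 ∈ M := by
    have hx : x.1 ∈ M := x.2
    exact star_mem hx
  refine ofRange_le_comap _ (fun x => ⟨star x.1, hmem x⟩) 1 (fun x => ?_)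
    fun x => ?_
  · change ‖star x.1‖ ≤ 1 * ‖x.1‖
    rw [norm_star, one_mul]
  · ext f g
    rw [SesqForm.adjoint_apply, formMap_apply, formMap_apply, inner_conj_symm,
      ← ContinuousLinearMap.adjoint_inner_right]
    rfl

theorem formSpace_eq_comap_adjoint (M : VonNeumannAlgebra H) (a : H →ₗ.[ℂ] H) (i j : Fin 2)
    (α β : Set.Ioi (0 : ℝ)) :
    formSpace M a i j α β = comap (SesqForm.adjoint a) (formSpace M a j i β α) :=
  le_antisymm (formSpace_le_comap_adjoint M a i j α β)
    ((comap_le_iff_of_involutive SesqForm.adjoint_adjoint).mpr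
      (formSpace_le_comap_adjoint M a j i β α))

theorem formSpace_le_comap_eval (M : VonNeumannAlgebra H) (a : H →ₗ.[ℂ] H) (i j : Fin 2)
    (α β : Set.Ioi (0 : ℝ)) (f g : commonDomain a) :
    formSpace M a i j α β ≤ comap (SesqForm.eval f g) scalars := by
  refine ofRange_le_comap _ (fun x => ⟪powOn a i α g, x.1 (powOn a j β f)⟫_ℂ)
    (‖powOn a i α g‖ * ‖powOn a j β f‖) (fun x => ?_) fun x => rfl
  calc ‖⟪powOn a i α g, x.1 (powOn a j β f)⟫_ℂ‖
      ≤ ‖powOn a i α g‖ * (‖x.1‖ * ‖powOn a j β f‖) :=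
        (norm_inner_le_norm _ _).trans (by gcongr; exact x.1.le_opNorm _)
    _ = ‖powOn a i α g‖ * ‖powOn a j β f‖ * ‖x‖ := by rw [Submodule.coe_norm]; ring

section Monotonicity

variable {M : VonNeumannAlgebra H} {a : H →ₗ.[ℂ] H} (ha : IsSelfAdjoint a)
  (hpos : IsPositiveOperator a) (haff : IsAffiliated a M)

include ha hpos haff

theorem family01_antitone (β : Set.Ioi (0 : ℝ)) : Antitone fun α => family01 M a α β :=
  fun _ _ h => formSpace_le (powOn_zero_of_le ha hpos haff h) ⟨1, one_mem M, fun _ => rfl⟩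

theorem family01_monotone (α : Set.Ioi (0 : ℝ)) : Monotone fun β => family01 M a α β :=
  fun _ _ h => formSpace_le ⟨1, one_mem M, fun _ => rfl⟩ (powOn_one_of_le ha hpos haff h)

theorem family10_antitone (β : Set.Ioi (0 : ℝ)) : Antitone fun α => family10 M a α β :=
  fun _ _ h => formSpace_le ⟨1, one_mem M, fun _ => rfl⟩ (powOn_zero_of_le ha hpos haff h)

theorem family10_monotone (α : Set.Ioi (0 : ℝ)) : Monotone fun β => family10 M a α β :=
  fun _ _ h => formSpace_le (powOn_one_of_le ha hpos haff h) ⟨1, one_mem M, fun _ => rfl⟩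

theorem diagSpace_zero_antitone : Antitone (diagSpace M a 0) := fun α β h => by
  have h' : (α / 2 : ℝ) ≤ β / 2 := div_le_div_of_nonneg_right h zero_le_two
  exact formSpace_le (powOn_zero_of_le ha hpos haff h') (powOn_zero_of_le ha hpos haff h')

theorem diagSpace_one_monotone : Monotone (diagSpace M a 1) := fun α β h => by
  have h' : (α / 2 : ℝ) ≤ β / 2 := div_le_div_of_nonneg_right h zero_le_two
  exact formSpace_le (powOn_one_of_le ha hpos haff h') (powOn_one_of_le ha hpos haff h')

theorem lowerLimLinfty_isLF : (lowerLimLinfty M a).IsLF := by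
  have hFr (i j : Fin 2) (α β : Set.Ioi (0 : ℝ)) : (formSpace M a i j α β).IsFrechet :=
    formSpace_isFrechet M a i j α β
  have hD : (projLimit (diagSpace M a 0)).IsFrechet :=
    projLimit_Ioi_isFrechet (diagSpace_zero_antitone ha hpos haff) fun _ => hFr _ _ _ _
  -- One increasing sequence of Fréchet spaces per corner; the (0, 0) corner is already Fréchet and
  -- gives a constant sequence.
  let F : Fin 2 → Fin 2 → ℕ → TopSubspace (SesqForm a) :=
    ![![fun _ => projLimit (diagSpace M a 0),
        fun n => projLimit fun α => family01 M a α (natShift 0 n)],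
      ![fun n => projLimit fun α => family10 M a α (natShift 0 n),
        fun n => diagSpace M a 1 (natShift 1 n)]]
  have hmono01 : Monotone fun β => projLimit fun α => family01 M a α β := fun _ _ h =>
    projLimit_mono fun α => family01_monotone ha hpos haff α h
  have hmono10 : Monotone fun β => projLimit fun α => family10 M a α β := fun _ _ h =>
    projLimit_mono fun α => family10_monotone ha hpos haff α h
  have hmono11 := diagSpace_one_monotone ha hpos haff
  have hF : lowerLimLinfty M a = block fun i j => indLimit (F i j) := by
    refine congrArg block (funext fun i => funext fun j => ?_)
    fin_cases i <;> fin_cases j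
    · exact (indLimit_const hD.isLocallyConvex).symm
    · exact indLimit_Ioi hmono01
    · exact indLimit_Ioi hmono10
    · exact indLimit_Ioi hmono11
  -- Evaluation is continuous on any single form space, hence on an intersection contained in one;
  -- the index chosen there is arbitrary.
  have hpt (i j : Fin 2) (n : ℕ) (f g : commonDomain a) :
      F i j n ≤ comap (SesqForm.eval f g) scalars := by
    have hs (i j : Fin 2) (α β : Set.Ioi (0 : ℝ)) := formSpace_le_comap_eval M a i j α β f g
    fin_cases i <;> fin_cases j
    · exact (projLimit_le _ (natShift 1 0)).trans (hs _ _ _ _)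
    · exact (projLimit_le _ (natShift 0 0)).trans (hs _ _ _ _)
    · exact (projLimit_le _ (natShift 0 0)).trans (hs _ _ _ _)
    · exact hs _ _ _ _
  rw [hF]
  refine isLF_block_indLimit (fun i j => ?_) (fun i j n => ?_) ?_
  · fin_cases i <;> fin_cases j
    · exact monotone_const
    · exact hmono01.comp (natShift_mono 0)
    · exact hmono10.comp (natShift_mono 0)
    · exact hmono11.comp (natShift_mono 1)
  · fin_cases i <;> fin_cases j
    · exact hD
    · exact projLimit_Ioi_isFrechet (family01_antitone ha hpos haff _) fun _ => hFr _ _ _ _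
    · exact projLimit_Ioi_isFrechet (family10_antitone ha hpos haff _) fun _ => hFr _ _ _ _
    · exact hFr _ _ _ _
  · refine t2Space_of_separating
      (fun k : (Fin 2 × Fin 2) × commonDomain a × commonDomain a =>
        (SesqForm.eval k.2.1 k.2.2).comp (Matrix.entryLinearMap ℂ (SesqForm a) k.1.1 k.1.2))
      (fun s hs => ?_) fun k => ?_
    · ext i j f g
      exact hs ((i, j), f, g)
    · refine le_comap_comp (block_le_comap _ k.1.1 k.1.2) ?_
      -- Continuity on the inductive limit is tested on its steps.
      rw [indLimit_le_iff
        (scalars_isFrechet.isLocallyConvex.comap (σ := RingHom.id ℂ) continuous_id _)]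
      exact fun n => hpt _ _ n _ _

end Monotonicity

/-- The upper and lower limits of the `(∞, 0)` corner are the adjoints of those of the `(0, ∞)`
corner. -/
theorem lowerLimit_family10_eq_upperLimit {M : VonNeumannAlgebra H} {a : H →ₗ.[ℂ] H}
    (h : lowerLimit (family01 M a) = upperLimit (family01 M a)) :
    lowerLimit (family10 M a) = upperLimit (family10 M a) := by
  have hf : family10 M a = fun α β => comap (SesqForm.adjoint a) (family01 M a α β) :=
    funext fun α => funext fun β => formSpace_eq_comap_adjoint M a 1 0 β α
  rw [hf, ← comap_lowerLimit Complex.continuous_conj SesqForm.adjoint_adjoint,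
    ← comap_upperLimit Complex.continuous_conj SesqForm.adjoint_adjoint, h]

end Operators

end

theorem theorem3 {H : Type*} [NormedAddCommGroup H] [InnerProductSpace ℂ H] [CompleteSpace H]
    (M : VonNeumannAlgebra H) (a : H →ₗ.[ℂ] H)
    (ha : IsSelfAdjoint a) (hpos : IsPositiveOperator a) (haff : IsAffiliated a M)
    (hlim : TopSubspace.lowerLimit (family01 M a) = TopSubspace.upperLimit (family01 M a)) :
    upperLimLinfty M a = lowerLimLinfty M a ∧ (lowerLimLinfty M a).IsLF := by
  refine ⟨?_, lowerLimLinfty_isLF ha hpos haff⟩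
  rw [upperLimLinfty, lowerLimLinfty, hlim, lowerLimit_family10_eq_upperLimit hlim]
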